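/- **Proposition 1.2.** Let $\mathbb C^{2,1}$ be $\mathbb C^3$ with the Hermitian form $\langle z,w\rangle=z_1\bar w_1+z_2\bar w_2-z_3\bar w_3$. The complex hyperbolic plane $H^2_{\mathbb C}$ is the set of negative lines in $\mathbb C^{2,1}$, with the Bergman distance $\rho$ given by $\cosh^2\big(\rho([z],[w])/2\big)=\frac{\langle z,w\rangle\langle w,z\rangle}{\langle z,z\rangle\langle w,w\rangle}$, and its boundary $\partial H^2_{\mathbb C}$ is the set of null lines. A complex geodesic is the projectivisation of a two-dimensional complex subspace of $\mathbb C^{2,1}$ that contains a negative vector; a polar vector of it is a vector $c$ with $\langle c,c\rangle>0$ whose orthogonal complement is this subspace, and $c$ is normalised if $\langle c,c\rangle=1$. A complex reflection of order $n$ in a complex geodesic with polar vector $c$ is the element of $\mathrm{PU}(2,1)$ represented by $z\mapsto -z+(1-\mu)\frac{\langle z,c\rangle}{\langle c,c\rangle}c$, where $\mu$ is a primitive $n$-th root of unity (for example $\mu=e^{2\pi i/n}$). Let $m,\alpha\in\mathbb R$, and let $C_1,C_2,C_3$ be complex geodesics (indices mod $3$) such that for each $k$ the geodesics $C_{k-1}$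 and $C_{k+1}$ either have no common point in $H^2_{\mathbb C}\cup\partial H^2_{\mathbb C}$ or have a common point in $\partial H^2_{\mathbb C}$, and such that the distances $m_k=\inf\{\rho(p,q): p\in C_{k-1}\cap H^2_{\mathbb C},\ q\in C_{k+1}\cap H^2_{\mathbb C}\}$ are $(m_1,m_2,m_3)=(m,m,0)$. Suppose that $\alpha$ is, modulo $2\pi$, the angular invariant of $(C_1,C_2,C_3)$, i.e. $\alpha\equiv\arg\big(\prod_{k=1}^3\langle c_{k-1},c_{k+1}\rangle\big)\pmod{2\pi}$ for normalised polar vectors $c_k$ of $C_k$. Let $\iota_1,\iota_2,\iota_3$ be complex reflections in $C_1,C_2,C_3$ of orders $2,3,2$ respectively, and let $\Gamma=\langle\iota_1,\iota_2,\iota_3\rangle$ (a complex hyperbolic ultra-parallel triangle group of type $[m,m,0;2,3,2]$ with angular invariant $\alpha$). If $$m\ge\log 3\qquad\text{and}\qquad \cos\alpha\le-\tfrac12,$$ then $\Gamma$ is a discrete subgroup of $\mathrm{PU}(2,1)$. -/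

import Mathlib

open scoped LinearAlgebra.Projectivization Matrix

noncomputable section

namespace ComplexHyperbolic

/-- The vector space underlying `ℂ^{2,1}`. -/
abbrev Vec : Type := Fin 3 → ℂ

/-- The Hermitian form of signature `(2,1)`:
`⟨z, w⟩ = z₁ w̄₁ + z₂ w̄₂ - z₃ w̄₃`. -/
def herm (z w : Vec) : ℂ :=
  z 0 * star (w 0) + z 1 * star (w 1) - z 2 * star (w 2)

/-- `⟨z, z⟩ < 0` (the value `⟨z, z⟩` is always real). -/
def IsNegative (z : Vec) : Prop := (herm z z).re < 0

/-- `⟨z, z⟩ = 0`; it is only used for nonzero `z`. -/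
def IsNull (z : Vec) : Prop := herm z z = 0

/-- `⟨z, z⟩ > 0`. -/
def IsPositive (z : Vec) : Prop := 0 < (herm z z).re

/-- The complex hyperbolic plane: the negative lines in `ℂ^{2,1}`. -/
def Plane : Type := {p : ℙ ℂ Vec // IsNegative p.rep}

/-- The boundary of the complex hyperbolic plane: the null lines in `ℂ^{2,1}`. -/
def Boundary : Type := {p : ℙ ℂ Vec // IsNull p.rep}

/-- The Bergman distance `ρ` on the complex hyperbolic plane, given by
`cosh² (ρ([z],[w]) / 2) = ⟨z,w⟩⟨w,z⟩ / (⟨z,z⟩⟨w,w⟩)`. -/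
def bergmanDist (p q : Plane) : ℝ :=
  2 * Real.arcosh (Real.sqrt
    ((herm p.1.rep q.1.rep * herm q.1.rep p.1.rep) /
      (herm p.1.rep p.1.rep * herm q.1.rep q.1.rep)).re)

/-- A complex geodesic of the complex hyperbolic plane, given by the two-dimensional complex
subspace of `ℂ^{2,1}` of which it is the projectivisation; the subspace has to contain a negative
vector for the geodesic to meet the complex hyperbolic plane. -/
structure ComplexGeodesic where
  subspace : Submodule ℂ Vec
  finrank_eq : Module.finrank ℂ subspace = 2
  exists_negative : ∃ z ∈ subspace, IsNegative z

/-- The point `p` of the complex projective plane lies on (the projectivisation of) `C`. -/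
def ComplexGeodesic.Contains (C : ComplexGeodesic) (p : ℙ ℂ Vec) : Prop :=
  p.submodule ≤ C.subspace

/-- The distance between two complex geodesics: the infimum of the Bergman distances between
their points in the complex hyperbolic plane. -/
def ComplexGeodesic.dist (C D : ComplexGeodesic) : ℝ :=
  sInf {d : ℝ | ∃ p q : Plane, C.Contains p.1 ∧ D.Contains q.1 ∧ d = bergmanDist p q}

/-- No common point in the complex hyperbolic plane or on its boundary. -/
def ComplexGeodesic.UltraParallel (C D : ComplexGeodesic) : Prop :=
  (∀ p : Plane, ¬ (C.Contains p.1 ∧ D.Contains p.1)) ∧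
    ∀ p : Boundary, ¬ (C.Contains p.1 ∧ D.Contains p.1)

/-- A common point on the boundary of the complex hyperbolic plane. -/
def ComplexGeodesic.Ideal (C D : ComplexGeodesic) : Prop :=
  ∃ p : Boundary, C.Contains p.1 ∧ D.Contains p.1

/-- `c` is a polar vector of the complex geodesic `C`: a positive vector whose orthogonal
complement is the subspace defining `C`. -/
def ComplexGeodesic.IsPolar (C : ComplexGeodesic) (c : Vec) : Prop :=
  IsPositive c ∧ ∀ z : Vec, z ∈ C.subspace ↔ herm c z = 0

/-- `c` is a normalised polar vector of `C`. -/
def ComplexGeodesic.IsNormalisedPolar (C : ComplexGeodesic) (c : Vec) : Prop :=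
  C.IsPolar c ∧ herm c c = 1

/-- The unitary group `U(2,1)` of the Hermitian form, as a subgroup of `GL(3, ℂ)`. -/
def U21 : Subgroup (GL (Fin 3) ℂ) where
  carrier := {A | ∀ z w : Vec, herm (A.1 *ᵥ z) (A.1 *ᵥ w) = herm z w}
  one_mem' := by
    intro z w
    simp
  mul_mem' := by
    intro A B hA hB z w
    have h := hA (B.1 *ᵥ z) (B.1 *ᵥ w)
    rw [hB z w] at h
    simpa [Matrix.mulVec_mulVec] using h
  inv_mem' := by
    intro A hA z w
    have h := hA ((A⁻¹).1 *ᵥ z) ((A⁻¹).1 *ᵥ w)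
    have e : A.1 * (A⁻¹).1 = 1 := by
      rw [← Units.val_mul, mul_inv_cancel, Units.val_one]
    rw [Matrix.mulVec_mulVec, Matrix.mulVec_mulVec, e, Matrix.one_mulVec, Matrix.one_mulVec] at h
    exact h.symm

/-- The scalar matrices in `U(2,1)`. -/
def scalars : Subgroup U21 where
  carrier := {A | ∃ a : ℂ, A.1.1 = a • (1 : Matrix (Fin 3) (Fin 3) ℂ)}
  one_mem' := ⟨1, by simp⟩
  mul_mem' := by
    rintro A B ⟨a, ha⟩ ⟨b, hb⟩
    refine ⟨a * b, ?_⟩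
    rw [Subgroup.coe_mul, Units.val_mul, ha, hb]
    simp [smul_smul, mul_comm]
  inv_mem' := by
    rintro A ⟨a, ha⟩
    have e : A.1.1 * (A⁻¹).1.1 = 1 := by
      rw [← Units.val_mul, ← Subgroup.coe_mul, mul_inv_cancel]
      rfl
    rw [ha, Matrix.smul_mul, one_mul] at e
    have a0 : a ≠ 0 := by
      rintro rfl
      rw [zero_smul] at e
      exact zero_ne_one e
    refine ⟨a⁻¹, ?_⟩
    rw [← e, smul_smul, inv_mul_cancel₀ a0, one_smul]

instance scalars_normal : scalars.Normal where
  conj_mem := by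
    rintro A ⟨a, ha⟩ B
    refine ⟨a, ?_⟩
    have e : B.1.1 * (B⁻¹).1.1 = 1 := by
      rw [← Units.val_mul, ← Subgroup.coe_mul, mul_inv_cancel]
      rfl
    rw [Subgroup.coe_mul, Subgroup.coe_mul, Units.val_mul, Units.val_mul, ha, Matrix.mul_smul,
      mul_one, Matrix.smul_mul, e]

/-- The projective unitary group `PU(2,1)`, the group of holomorphic isometries of the complex
hyperbolic plane. It carries the quotient topology of the topology of `U(2,1) ⊆ GL(3, ℂ)`. -/
abbrev PU21 : Type := U21 ⧸ scalars

/-- `g` is a complex reflection of order `n` in the complex geodesic `C`, i.e. the class of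
`z ↦ -z + (1 - μ) (⟨z, c⟩ / ⟨c, c⟩) c`, where `c` is a polar vector of `C` and `μ` is a primitive
`n`-th root of unity. The minimal reflection of order `n` has `μ = exp (2πi / n)`; the other
choices of `μ` give the powers of the minimal one that still have order `n`. -/
def IsComplexReflection (n : ℕ) (C : ComplexGeodesic) (g : PU21) : Prop :=
  ∃ (c : Vec) (μ : ℂ) (A : U21), C.IsPolar c ∧ IsPrimitiveRoot μ n ∧
    (∀ z : Vec, A.1.1 *ᵥ z = -z + ((1 - μ) * (herm z c / herm c c)) • c) ∧
    g = QuotientGroup.mk A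

/-- `C = (C₁, C₂, C₃)`, indexed cyclically by `Fin 3`, is an ultra-parallel `[m₁, m₂, m₃]`-triangle:
any two of its sides are ultra-parallel, or ideal (the case of distance zero), and
`m_k = dist (C_{k-1}, C_{k+1})`. -/
def IsUltraParallelTriangle (C : Fin 3 → ComplexGeodesic) (m : Fin 3 → ℝ) : Prop :=
  ∀ k : Fin 3, ((C (k - 1)).UltraParallel (C (k + 1)) ∨ (C (k - 1)).Ideal (C (k + 1))) ∧
    (C (k - 1)).dist (C (k + 1)) = m k

/-- `α` is (a representative modulo `2π` of) the angular invariant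
`arg (∏ₖ ⟨c_{k-1}, c_{k+1}⟩)` of the triangle `C`, where `c_k` is a normalised polar vector of
`C_k`. The product does not depend on the choice of the `c_k`. -/
def HasAngularInvariant (C : Fin 3 → ComplexGeodesic) (α : ℝ) : Prop :=
  ∃ c : Fin 3 → Vec, (∀ k, (C k).IsNormalisedPolar (c k)) ∧
    ((Complex.arg (∏ k : Fin 3, herm (c (k - 1)) (c (k + 1))) : ℝ) : Real.Angle) = (α : Real.Angle)

/-- `Γ` is a complex hyperbolic ultra-parallel triangle group of type
`[m₁, m₂, m₃; n₁, n₂, n₃]` with angular invariant `α`. -/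
def IsUltraParallelTriangleGroup (Γ : Subgroup PU21) (m : Fin 3 → ℝ) (n : Fin 3 → ℕ) (α : ℝ) :
    Prop :=
  ∃ (C : Fin 3 → ComplexGeodesic) (ι : Fin 3 → PU21),
    IsUltraParallelTriangle C m ∧ HasAngularInvariant C α ∧
    (∀ k, IsComplexReflection (n k) (C k) (ι k)) ∧
    Γ = Subgroup.closure (Set.range ι)

end ComplexHyperbolic

end

/-!
Let `q` span the common boundary point of the first two geodesics, and let `q₀` be its image under
the involution `ι₃`. In Heisenberg coordinates based at `q`, the first two geodesics are vertical
chains over points `x₁`, `x₂` of the plane, `ι₃` exchanges the interior and the exterior of the unit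
Cygan ball `U` around `q₀`, and the projection of `q₀` is the origin. The hypotheses become
`|x₁|, |x₂| ≥ 2 / √3` (this is `cosh (m / 2)` for `m = log 3`) and an angle of at least `120°`
between `x₁` and `x₂`.

The group `G` generated by `ι₁`, `ι₂` acts on the plane through the rotation group of the `(2,3,6)`
triangle, and its elements are described by Eisenstein integers. Such an element moves the origin by
`2 a x₁ + (ω - 1) b x₂` up to a unimodular factor, with `a, b ∈ ℤ[ω]`, and an estimate for triangles
with Eisenstein sides shows that this has modulus at least `2` unless `a = b = 0`
(`two_le_norm_eisenstein_combination`). For `a = b = 0` the element is a vertical translation by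
`|β|² s` with `s ∈ ℤ[ω]` and `|β| = |x₁ - x₂| ≥ 2`. In either case a nontrivial element of `G` moves
`U` off itself (`AsymptoticTriangle.IsEisenstein.eq_one`).

Discreteness is then the ping-pong argument of Klein's combination theorem: a word in which `ι₃`
occurs maps a high horoball at `q` into a translate of `U` under `G`, and these translates do not
meet the horoball; a nontrivial element of `G` maps `U` off itself. So no nontrivial element of the
group is in the open neighbourhood of `1` consisting of the elements that keep one given point in
the horoball and another one in the interior of `U` (`AsymptoticTriangle.eq_one_of_mem_identityNhd`).

All of this is carried out with vectors and the Hermitian form; `U` is the set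
`|⟨z, q₀⟩| ≤ |⟨z, q⟩|`, and the only metric input is that the form is positive semidefinite on the
orthogonal complement of a null or negative vector.
-/

open scoped LinearAlgebra.Projectivization Matrix
open scoped ComplexConjugate

namespace ComplexHyperbolic

/-! ### The Hermitian form -/

theorem herm_add_left (x y z : Vec) : herm (x + y) z = herm x z + herm y z := by
  simp [herm]; ring

theorem herm_sub_left (x y z : Vec) : herm (x - y) z = herm x z - herm y z := by
  simp [herm]; ring

theorem herm_smul_left (a : ℂ) (x z : Vec) : herm (a • x) z = a * herm x z := by
  simp [herm]; ring

theorem herm_add_right (x y z : Vec) : herm x (y + z) = herm x y + herm x z := by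
  simp [herm]; ring

theorem herm_sub_right (x y z : Vec) : herm x (y - z) = herm x y - herm x z := by
  simp [herm]; ring

theorem herm_smul_right (a : ℂ) (x z : Vec) : herm x (a • z) = conj a * herm x z := by
  simp [herm]; ring

theorem conj_herm (x y : Vec) : conj (herm x y) = herm y x := by
  simp [herm]; ring

theorem herm_self_eq_re (x : Vec) : herm x x = ((herm x x).re : ℂ) :=
  (Complex.conj_eq_iff_real.mp (conj_herm x x)).elim fun r h => by rw [h]; simp

theorem herm_comm_eq_zero {x y : Vec} (h : herm x y = 0) : herm y x = 0 := by
  rw [← conj_herm, h, map_zero]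

theorem norm_herm_comm (x y : Vec) : ‖herm x y‖ = ‖herm y x‖ := by
  rw [← conj_herm, Complex.norm_conj]

theorem herm_mul_herm_swap (x y : Vec) : herm x y * herm y x = ((‖herm x y‖ ^ 2 : ℝ) : ℂ) := by
  rw [← conj_herm x y, Complex.mul_conj, Complex.normSq_eq_norm_sq]

theorem re_herm_smul_self (a : ℂ) (x : Vec) :
    (herm (a • x) (a • x)).re = ‖a‖ ^ 2 * (herm x x).re := by
  rw [herm_smul_left, herm_smul_right, ← mul_assoc, Complex.mul_conj, Complex.re_ofReal_mul,
    Complex.normSq_eq_norm_sq]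

theorem eq_zero_of_forall_herm_eq_zero {x : Vec} (h : ∀ z, herm x z = 0) : x = 0 := by
  have h0 := h (Pi.single 0 1)
  have h1 := h (Pi.single 1 1)
  have h2 := h (Pi.single 2 1)
  simp [herm] at h0 h1 h2
  funext i
  fin_cases i <;> simp [h0, h1, h2]

theorem re_herm_self (x : Vec) :
    (herm x x).re = ‖x 0‖ ^ 2 + ‖x 1‖ ^ 2 - ‖x 2‖ ^ 2 := by
  have e : ∀ z : ℂ, (z * star z).re = ‖z‖ ^ 2 := fun z => by
    rw [Complex.star_def, Complex.mul_conj, Complex.ofReal_re, Complex.normSq_eq_norm_sq]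
  simp only [herm, Complex.sub_re, Complex.add_re, e]

/-- The form is positive semidefinite on the orthogonal complement of a nonzero null or negative
vector. -/
theorem re_herm_self_nonneg {q x : Vec} (hq : q ≠ 0) (hqq : (herm q q).re ≤ 0)
    (h : herm x q = 0) : 0 ≤ (herm x x).re := by
  rw [re_herm_self] at hqq ⊢
  have e : x 2 * star (q 2) = x 0 * star (q 0) + x 1 * star (q 1) := by
    rw [herm] at h; linear_combination -h
  have e' : ‖x 2‖ * ‖q 2‖ ≤ ‖x 0‖ * ‖q 0‖ + ‖x 1‖ * ‖q 1‖ := by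
    have := norm_add_le (x 0 * star (q 0)) (x 1 * star (q 1))
    rw [← e] at this
    simpa using this
  have hpos : 0 < ‖q 2‖ ^ 2 := by
    by_contra hn
    have h2 : ‖q 2‖ ^ 2 = 0 := le_antisymm (not_lt.mp hn) (sq_nonneg _)
    have h0 : ‖q 0‖ ^ 2 = 0 := by nlinarith [sq_nonneg ‖q 0‖, sq_nonneg ‖q 1‖]
    have h1 : ‖q 1‖ ^ 2 = 0 := by nlinarith [sq_nonneg ‖q 0‖, sq_nonneg ‖q 1‖]
    apply hq
    funext i
    fin_cases i
    · simpa using h0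
    · simpa using h1
    · simpa using h2
  have cs : (‖x 0‖ * ‖q 0‖ + ‖x 1‖ * ‖q 1‖) ^ 2
      ≤ (‖x 0‖ ^ 2 + ‖x 1‖ ^ 2) * (‖q 0‖ ^ 2 + ‖q 1‖ ^ 2) := by
    nlinarith [sq_nonneg (‖x 0‖ * ‖q 1‖ - ‖x 1‖ * ‖q 0‖)]
  have sq : (‖x 2‖ * ‖q 2‖) ^ 2 ≤ (‖x 0‖ * ‖q 0‖ + ‖x 1‖ * ‖q 1‖) ^ 2 :=
    pow_le_pow_left₀ (by positivity) e' 2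
  have b : (‖x 0‖ ^ 2 + ‖x 1‖ ^ 2) * (‖q 0‖ ^ 2 + ‖q 1‖ ^ 2)
      ≤ (‖x 0‖ ^ 2 + ‖x 1‖ ^ 2) * ‖q 2‖ ^ 2 :=
    mul_le_mul_of_nonneg_left (by linarith) (by positivity)
  have f : ‖x 2‖ ^ 2 * ‖q 2‖ ^ 2 ≤ (‖x 0‖ ^ 2 + ‖x 1‖ ^ 2) * ‖q 2‖ ^ 2 := by
    rw [← mul_pow]; linarith
  linarith [le_of_mul_le_mul_right f hpos]

theorem IsNegative.ne_zero {p : Vec} (hp : IsNegative p) : p ≠ 0 := by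
  rintro rfl
  simp [IsNegative, herm] at hp

theorem re_herm_sub_smul (x e : Vec) (t : ℂ) :
    (herm (x - t • e) (x - t • e)).re
      = (herm x x).re - 2 * (conj t * herm x e).re + ‖t‖ ^ 2 * (herm e e).re := by
  have h : herm (x - t • e) (x - t • e)
      = herm x x - (conj t * herm x e + conj (conj t * herm x e)) + t * conj t * herm e e := by
    rw [map_mul, conj_herm, Complex.conj_conj]
    simp only [herm_sub_left, herm_sub_right, herm_smul_left, herm_smul_right]
    ring
  rw [h, Complex.add_conj, Complex.mul_conj, Complex.add_re, Complex.sub_re,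
    Complex.re_ofReal_mul, Complex.normSq_eq_norm_sq, Complex.ofReal_re]

theorem re_herm_sub_proj {x e : Vec} (he : herm e e ≠ 0) :
    (herm (x - (herm x e / herm e e) • e) (x - (herm x e / herm e e) • e)).re
      = (herm x x).re - ‖herm x e‖ ^ 2 / (herm e e).re := by
  have hr : (herm e e).re ≠ 0 := by
    intro h0; apply he; rw [herm_self_eq_re, h0]; simp
  have e1 : (conj (herm x e / herm e e) * herm x e).re = ‖herm x e‖ ^ 2 / (herm e e).re := by
    rw [map_div₀, conj_herm e e, div_mul_eq_mul_div, mul_comm, Complex.mul_conj, herm_self_eq_re e,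
      ← Complex.ofReal_div, Complex.ofReal_re, Complex.normSq_eq_norm_sq, Complex.ofReal_re]
  have e2 : ‖herm x e / herm e e‖ ^ 2 = ‖herm x e‖ ^ 2 / (herm e e).re ^ 2 := by
    rw [norm_div, div_pow, herm_self_eq_re e, Complex.norm_real, Real.norm_eq_abs, sq_abs,
      Complex.ofReal_re]
  rw [re_herm_sub_smul, e1, e2]
  field_simp
  ring

theorem herm_sub_proj {x e : Vec} (he : herm e e ≠ 0) :
    herm (x - (herm x e / herm e e) • e) e = 0 := by
  rw [herm_sub_left, herm_smul_left, div_mul_cancel₀ _ he, sub_self]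

theorem IsNegative.herm_self_ne_zero {p : Vec} (hp : IsNegative p) : herm p p ≠ 0 := by
  intro h; rw [IsNegative, h] at hp; simp at hp

theorem IsPositive.herm_self_ne_zero {p : Vec} (hp : IsPositive p) : herm p p ≠ 0 := by
  intro h; rw [IsPositive, h] at hp; simp at hp

/-- The reversed Cauchy-Schwarz inequality. -/
theorem IsNegative.mul_le_norm_herm_sq {p : Vec} (hp : IsNegative p) (r : Vec) :
    (herm p p).re * (herm r r).re ≤ ‖herm p r‖ ^ 2 := by
  have h := re_herm_self_nonneg hp.ne_zero hp.le (herm_sub_proj (x := r) hp.herm_self_ne_zero)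
  rw [re_herm_sub_proj hp.herm_self_ne_zero, norm_herm_comm] at h
  have hp' : (herm p p).re < 0 := hp
  have := mul_nonneg_of_nonpos_of_nonpos hp'.le (neg_nonpos.mpr h)
  have e : (herm p p).re * -((herm r r).re - ‖herm p r‖ ^ 2 / (herm p p).re)
      = ‖herm p r‖ ^ 2 - (herm p p).re * (herm r r).re := by
    have := hp'.ne
    field_simp
    ring
  linarith

/-! ### The distance between complex geodesics -/

theorem ComplexGeodesic.contains_iff (C : ComplexGeodesic) (p : ℙ ℂ Vec) :
    C.Contains p ↔ p.rep ∈ C.subspace := by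
  rw [ComplexGeodesic.Contains, Projectivization.submodule_eq,
    Submodule.span_singleton_le_iff_mem]

theorem ComplexGeodesic.IsPolar.herm_rep {C : ComplexGeodesic} {c : Vec} (hc : C.IsPolar c)
    {p : ℙ ℂ Vec} (hp : C.Contains p) : herm c p.rep = 0 :=
  (hc.2 _).1 ((C.contains_iff p).1 hp)

theorem ComplexGeodesic.contains_mk (C : ComplexGeodesic) {v : Vec} (hv : v ≠ 0)
    (h : v ∈ C.subspace) : C.Contains (Projectivization.mk ℂ v hv) := by
  rw [ComplexGeodesic.Contains, Projectivization.submodule_mk,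
    Submodule.span_singleton_le_iff_mem]
  exact h

theorem exists_rep_mk_eq {v : Vec} (hv : v ≠ 0) :
    ∃ a : ℂ, a ≠ 0 ∧ (Projectivization.mk ℂ v hv).rep = a • v := by
  obtain ⟨a, ha⟩ := Projectivization.exists_smul_eq_mk_rep ℂ v hv
  exact ⟨a, a.ne_zero, ha.symm⟩

theorem isNegative_smul {a : ℂ} (ha : a ≠ 0) {v : Vec} : IsNegative (a • v) ↔ IsNegative v := by
  have : 0 < ‖a‖ ^ 2 := by positivity
  rw [IsNegative, IsNegative, re_herm_smul_self, mul_neg_iff]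
  constructor
  · rintro (h | h)
    · exact h.2
    · linarith [h.1]
  · exact fun h => Or.inl ⟨this, h⟩

theorem IsNegative.exists_plane {v : Vec} (hv : IsNegative v) :
    ∃ (p : Plane) (a : ℂ), a ≠ 0 ∧ p.1.rep = a • v ∧
      ∀ C : ComplexGeodesic, v ∈ C.subspace → C.Contains p.1 := by
  obtain ⟨a, ha, e⟩ := exists_rep_mk_eq hv.ne_zero
  exact ⟨⟨Projectivization.mk ℂ v hv.ne_zero, e.symm ▸ (isNegative_smul ha).2 hv⟩, a, ha, e,
    fun C hC => C.contains_mk hv.ne_zero hC⟩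

theorem ComplexGeodesic.UltraParallel.not_isNegative {C D : ComplexGeodesic}
    (h : C.UltraParallel D) {v : Vec} (hC : v ∈ C.subspace) (hD : v ∈ D.subspace) :
    ¬ IsNegative v := by
  intro hv
  obtain ⟨p, -, -, -, hp⟩ := hv.exists_plane
  exact h.1 p ⟨hp C hC, hp D hD⟩

theorem ComplexGeodesic.UltraParallel.not_isNull {C D : ComplexGeodesic}
    (h : C.UltraParallel D) {v : Vec} (hC : v ∈ C.subspace) (hD : v ∈ D.subspace)
    (hv : v ≠ 0) : ¬ IsNull v := by
  intro hn
  obtain ⟨a, ha, e⟩ := exists_rep_mk_eq hv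
  have hn' : IsNull (Projectivization.mk ℂ v hv).rep := by
    rw [IsNull] at hn ⊢
    rw [e, herm_smul_left, herm_smul_right, hn]
    simp
  exact h.2 ⟨Projectivization.mk ℂ v hv, hn'⟩ ⟨C.contains_mk hv hC, D.contains_mk hv hD⟩

/-- The quantity `⟨z, w⟩⟨w, z⟩ / (⟨z, z⟩⟨w, w⟩)` in the formula for the Bergman distance. -/
noncomputable def distRatio (z w : Vec) : ℝ := ‖herm z w‖ ^ 2 / ((herm z z).re * (herm w w).re)

theorem bergmanDist_eq (p q : Plane) :
    bergmanDist p q = 2 * Real.arcosh (Real.sqrt (distRatio p.1.rep q.1.rep)) := by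
  rw [bergmanDist, distRatio, herm_mul_herm_swap, herm_self_eq_re p.1.rep,
    herm_self_eq_re q.1.rep, ← Complex.ofReal_mul, ← Complex.ofReal_div, Complex.ofReal_re,
    Complex.ofReal_re, Complex.ofReal_re]

theorem one_le_distRatio {z w : Vec} (hz : IsNegative z) (hw : IsNegative w) :
    1 ≤ distRatio z w := by
  rw [distRatio, le_div_iff₀ (mul_pos_of_neg_of_neg hz hw), one_mul]
  exact hz.mul_le_norm_herm_sq w

theorem distRatio_smul_smul {a b : ℂ} (ha : a ≠ 0) (hb : b ≠ 0) (z w : Vec) :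
    distRatio (a • z) (b • w) = distRatio z w := by
  have ha' : ‖a‖ ≠ 0 := norm_ne_zero_iff.2 ha
  have hb' : ‖b‖ ≠ 0 := norm_ne_zero_iff.2 hb
  rw [distRatio, distRatio, re_herm_smul_self, re_herm_smul_self, herm_smul_left,
    herm_smul_right, norm_mul, norm_mul, Complex.norm_conj]
  field_simp

theorem bergmanDist_nonneg (p q : Plane) : 0 ≤ bergmanDist p q := by
  rw [bergmanDist_eq]
  have := Real.arcosh_nonneg (Real.one_le_sqrt.2 (one_le_distRatio p.2 q.2))
  positivity

theorem ComplexGeodesic.dist_le {C D : ComplexGeodesic} {z w : Vec} (hz : z ∈ C.subspace)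
    (hw : w ∈ D.subspace) (nz : IsNegative z) (nw : IsNegative w) :
    C.dist D ≤ 2 * Real.arcosh (Real.sqrt (distRatio z w)) := by
  obtain ⟨p, a, ha, ea, hp⟩ := nz.exists_plane
  obtain ⟨r, b, hb, eb, hr⟩ := nw.exists_plane
  refine csInf_le ⟨0, ?_⟩ ⟨p, r, hp C hz, hr D hw, ?_⟩
  · rintro d ⟨p, q, -, -, rfl⟩
    exact bergmanDist_nonneg p q
  · rw [bergmanDist_eq, ea, eb, distRatio_smul_smul ha hb]

theorem ComplexGeodesic.le_dist {C D : ComplexGeodesic} {k : ℝ} (hk : 0 < k)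
    (h : ∀ z ∈ C.subspace, ∀ w ∈ D.subspace, IsNegative z → IsNegative w → k ≤ distRatio z w) :
    2 * Real.arcosh (Real.sqrt k) ≤ C.dist D := by
  refine le_csInf ?_ ?_
  · obtain ⟨z, hz, nz⟩ := C.exists_negative
    obtain ⟨w, hw, nw⟩ := D.exists_negative
    obtain ⟨p, -, -, -, hp⟩ := nz.exists_plane
    obtain ⟨r, -, -, -, hr⟩ := nw.exists_plane
    exact ⟨_, p, r, hp C hz, hr D hw, rfl⟩
  · rintro d ⟨p, q, hp, hq, rfl⟩
    have hle := h _ ((C.contains_iff _).1 hp) _ ((D.contains_iff _).1 hq) p.2 q.2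
    rw [bergmanDist_eq]
    have := (Real.arcosh_le_arcosh (Real.sqrt_pos.2 hk)
      (Real.sqrt_pos.2 (hk.trans_le hle))).2 (Real.sqrt_le_sqrt hle)
    linarith

theorem two_mul_arcosh_sqrt_four_thirds :
    2 * Real.arcosh (Real.sqrt (4 / 3)) = Real.log 3 := by
  have e : Real.sqrt (4 / 3) + Real.sqrt (Real.sqrt (4 / 3) ^ 2 - 1) = Real.sqrt 3 := by
    have h3 : (0 : ℝ) < Real.sqrt 3 := by positivity
    have h33 : Real.sqrt 3 * Real.sqrt 3 = 3 := Real.mul_self_sqrt (by norm_num)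
    have h1 : Real.sqrt (4 / 3) = 2 * Real.sqrt 3 / 3 := by
      rw [Real.sqrt_eq_iff_mul_self_eq (by norm_num) (by positivity)]
      nlinarith
    have h2 : Real.sqrt (1 / 3) = Real.sqrt 3 / 3 := by
      rw [Real.sqrt_eq_iff_mul_self_eq (by norm_num) (by positivity)]
      nlinarith
    rw [Real.sq_sqrt (by norm_num), show (4 / 3 - 1 : ℝ) = 1 / 3 by norm_num, h1, h2]
    ring
  rw [Real.arcosh, e, Real.log_sqrt (by norm_num)]
  ring

theorem ComplexGeodesic.dist_lt_log_three_of_distRatio_lt {C D : ComplexGeodesic} {z w : Vec}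
    (hz : z ∈ C.subspace) (hw : w ∈ D.subspace) (nz : IsNegative z) (nw : IsNegative w)
    (h : distRatio z w < 4 / 3) : C.dist D < Real.log 3 := by
  refine (ComplexGeodesic.dist_le hz hw nz nw).trans_lt ?_
  rw [← two_mul_arcosh_sqrt_four_thirds]
  have h1 := one_le_distRatio nz nw
  have := (Real.arcosh_lt_arcosh (Real.sqrt_pos.2 (by linarith)) (Real.sqrt_pos.2 (by norm_num))).2
    (Real.sqrt_lt_sqrt (by linarith) h)
  linarith

/-- Moving points of two asymptotic geodesics towards their common boundary point brings them
arbitrarily close to each other. -/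
theorem ComplexGeodesic.Ideal.dist_lt_log_three {C D : ComplexGeodesic} (h : C.Ideal D) :
    C.dist D < Real.log 3 := by
  obtain ⟨b, hbC, hbD⟩ := h
  set q := b.1.rep with hq
  have q0 : q ≠ 0 := b.1.rep_nonzero
  have qq : herm q q = 0 := b.2
  rw [ComplexGeodesic.contains_iff] at hbC hbD
  have key : ∀ E : ComplexGeodesic, ∃ z ∈ E.subspace, IsNegative z ∧ herm z q = -1 := by
    intro E
    obtain ⟨z, hz, nz⟩ := E.exists_negative
    have hzq : herm z q ≠ 0 := fun h0 =>
      absurd (re_herm_self_nonneg q0 (by rw [qq]; simp) h0) (not_le.2 nz)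
    refine ⟨(-(herm z q)⁻¹) • z, E.subspace.smul_mem _ hz,
      (isNegative_smul (neg_ne_zero.2 (inv_ne_zero hzq))).2 nz, ?_⟩
    rw [herm_smul_left, neg_mul, inv_mul_cancel₀ hzq]
  obtain ⟨z, hz, nz, ez⟩ := key C
  obtain ⟨w, hw, nw, ew⟩ := key D
  have ez' : herm q z = -1 := by rw [← conj_herm, ez]; simp
  have ew' : herm q w = -1 := by rw [← conj_herm, ew]; simp
  set g := herm z w with hg
  set t : ℝ := 4 * ‖g‖ + 1 with ht
  have t0 : 0 < t := by positivity
  have self : ∀ y : Vec, herm y q = -1 → herm q y = -1 →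
      (herm (y + (t : ℂ) • q) (y + (t : ℂ) • q)).re = (herm y y).re - 2 * t := by
    intro y h1 h2
    have : herm (y + (t : ℂ) • q) (y + (t : ℂ) • q) = herm y y - ((2 * t : ℝ) : ℂ) := by
      simp only [herm_add_left, herm_add_right, herm_smul_left, herm_smul_right, h1, h2, qq,
        Complex.conj_ofReal]
      push_cast
      ring
    rw [this, Complex.sub_re, Complex.ofReal_re]
  have cross : herm (z + (t : ℂ) • q) (w + (t : ℂ) • q) = g - ((2 * t : ℝ) : ℂ) := by
    simp only [herm_add_left, herm_add_right, herm_smul_left, herm_smul_right, ez, ew', qq,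
      Complex.conj_ofReal]
    push_cast
    ring
  have nz' : (herm z z).re < 0 := nz
  have nw' : (herm w w).re < 0 := nw
  refine dist_lt_log_three_of_distRatio_lt (z := z + (t : ℂ) • q) (w := w + (t : ℂ) • q)
    (C.subspace.add_mem hz (C.subspace.smul_mem _ hbC))
    (D.subspace.add_mem hw (D.subspace.smul_mem _ hbD)) ?_ ?_ ?_
  · rw [IsNegative, self z ez ez']; linarith
  · rw [IsNegative, self w ew ew']; linarith
  · rw [distRatio, self z ez ez', self w ew ew', cross,
      div_lt_iff₀ (mul_pos_of_neg_of_neg (by linarith) (by linarith))]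
    have hn : ‖g - ((2 * t : ℝ) : ℂ)‖ ≤ ‖g‖ + 2 * t := by
      refine (norm_sub_le _ _).trans ?_
      rw [Complex.norm_real, Real.norm_eq_abs, abs_of_pos (by linarith)]
    have h2 : ‖g - ((2 * t : ℝ) : ℂ)‖ ^ 2 ≤ (‖g‖ + 2 * t) ^ 2 :=
      pow_le_pow_left₀ (norm_nonneg _) hn 2
    have h3 : (2 * t) * (2 * t) ≤ ((herm z z).re - 2 * t) * ((herm w w).re - 2 * t) := by
      nlinarith
    have g0 := norm_nonneg g
    nlinarith

theorem ComplexGeodesic.UltraParallel.one_lt {C D : ComplexGeodesic} (h : C.UltraParallel D)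
    {c d : Vec} (hc : C.IsNormalisedPolar c) (hd : D.IsNormalisedPolar d) :
    1 < ‖herm c d‖ ^ 2 := by
  by_contra! hle
  rcases hle.lt_or_eq with hlt | heq
  · -- the conjugate cross product of `c` and `d` with the third coordinate negated
    -- is orthogonal to both
    set v : Vec := ![conj (c 1 * d 2 - c 2 * d 1), conj (c 2 * d 0 - c 0 * d 2),
      -conj (c 0 * d 1 - c 1 * d 0)] with hv
    have h1 : herm c v = 0 := by simp [herm, hv]; ring
    have h2 : herm d v = 0 := by simp [herm, hv]; ring
    have h3 : herm v v = herm c d * herm d c - herm c c * herm d d := by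
      simp [herm, hv]; ring
    refine h.not_isNegative ((hc.1.2 v).2 h1) ((hd.1.2 v).2 h2) ?_
    rw [IsNegative, h3, hc.2, hd.2, herm_mul_herm_swap, mul_one, Complex.sub_re,
      Complex.ofReal_re, Complex.one_re]
    linarith
  · have hs : herm d c * herm c d = 1 := by
      rw [mul_comm, herm_mul_herm_swap, heq, Complex.ofReal_one]
    by_cases hw : d - herm d c • c = 0
    · obtain ⟨z, hz, nz⟩ := C.exists_negative
      refine h.not_isNegative hz ((hd.1.2 z).2 ?_) nz
      rw [sub_eq_zero.1 hw, herm_smul_left, (hc.1.2 z).1 hz, mul_zero]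
    · have h1 : herm c (d - herm d c • c) = 0 := by
        rw [herm_sub_right, herm_smul_right, conj_herm, hc.2]; ring
      have h2 : herm d (d - herm d c • c) = 0 := by
        rw [herm_sub_right, herm_smul_right, conj_herm, hd.2, mul_comm, hs, sub_self]
      refine h.not_isNull ((hc.1.2 _).2 h1) ((hd.1.2 _).2 h2) hw ?_
      rw [IsNull, herm_sub_left, herm_smul_left, h1, h2]; ring

/-- The ratio of any two points of geodesics with normalised polar vectors `c` and `d` is at least
`|⟨c, d⟩|²`. -/
theorem norm_herm_sq_le_distRatio {c d z w : Vec} (hc : herm c c = 1) (hd : herm d d = 1)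
    (hz : herm c z = 0) (hw : herm d w = 0) (nz : IsNegative z) (nw : IsNegative w) :
    ‖herm c d‖ ^ 2 ≤ distRatio z w := by
  have nz' : (herm z z).re < 0 := nz
  have nw' : (herm w w).re < 0 := nw
  -- Cauchy-Schwarz in the positive definite complement of `w`
  have h1 : ‖herm c d‖ ^ 2 ≤ 1 - ‖herm c w‖ ^ 2 / (herm w w).re := by
    set c' := c - (herm c w / herm w w) • w with hc'
    have e1 : herm c' d = herm c d := by
      rw [hc', herm_sub_left, herm_smul_left, herm_comm_eq_zero hw]; ring
    have e2 : herm c' w = 0 := herm_sub_proj nw.herm_self_ne_zero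
    have := re_herm_self_nonneg (x := c' - (herm c' d / herm d d) • d) nw.ne_zero nw'.le (by
      rw [herm_sub_left, herm_smul_left, e2, hw]; ring)
    rw [re_herm_sub_proj (by rw [hd]; exact one_ne_zero), e1, hd,
      re_herm_sub_proj nw.herm_self_ne_zero, hc] at this
    simp only [Complex.one_re, div_one] at this
    linarith
  -- the reversed Cauchy-Schwarz inequality in the complement of `c`
  have h2 : (herm z z).re * ((herm w w).re - ‖herm c w‖ ^ 2) ≤ ‖herm z w‖ ^ 2 := by
    have := nz.mul_le_norm_herm_sq (w - (herm w c / herm c c) • c)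
    rw [re_herm_sub_proj (by rw [hc]; exact one_ne_zero), herm_sub_right, herm_smul_right,
      herm_comm_eq_zero hz, hc, norm_herm_comm w c] at this
    simpa using this
  rw [distRatio, le_div_iff₀ (mul_pos_of_neg_of_neg nz' nw')]
  have e : (1 - ‖herm c w‖ ^ 2 / (herm w w).re) * ((herm z z).re * (herm w w).re)
      = (herm z z).re * ((herm w w).re - ‖herm c w‖ ^ 2) := by
    have := nw'.ne
    field_simp
  calc _ ≤ _ := mul_le_mul_of_nonneg_right h1 (mul_pos_of_neg_of_neg nz' nw').le
    _ ≤ _ := e ▸ h2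

theorem ComplexGeodesic.UltraParallel.dist_pos {C D : ComplexGeodesic} (h : C.UltraParallel D)
    {c d : Vec} (hc : C.IsNormalisedPolar c) (hd : D.IsNormalisedPolar d) : 0 < C.dist D := by
  have h1 := h.one_lt hc hd
  have := ComplexGeodesic.le_dist (C := C) (D := D) (k := ‖herm c d‖ ^ 2) (by linarith)
    fun z hz w hw nz nw => norm_herm_sq_le_distRatio hc.2 hd.2 ((hc.1.2 z).1 hz)
      ((hd.1.2 w).1 hw) nz nw
  rw [Real.sqrt_sq (norm_nonneg _)] at this
  have := Real.arcosh_pos ((one_lt_sq_iff₀ (norm_nonneg _)).1 h1)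
  linarith

/-- The endpoints of the common perpendicular of two ultra-parallel geodesics with normalised polar
vectors `c` and `d` are `d - ⟨d, c⟩c` and `c - ⟨c, d⟩d`; they realise the ratio `|⟨c, d⟩|²`. -/
theorem ComplexGeodesic.UltraParallel.four_thirds_le {C D : ComplexGeodesic}
    (h : C.UltraParallel D) {c d : Vec} (hc : C.IsNormalisedPolar c)
    (hd : D.IsNormalisedPolar d) (hdist : Real.log 3 ≤ C.dist D) : 4 / 3 ≤ ‖herm c d‖ ^ 2 := by
  by_contra! hlt
  have h1 := h.one_lt hc hd
  have key : ∀ a b : Vec, herm a a = 1 → herm b b = 1 →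
      (herm (a - herm a b • b) (a - herm a b • b)).re = 1 - ‖herm a b‖ ^ 2 := by
    intro a b ha hb
    have := re_herm_sub_proj (x := a) (e := b) (by rw [hb]; exact one_ne_zero)
    rwa [ha, hb, div_one, Complex.one_re, div_one] at this
  have k1 := key d c hd.2 hc.2
  have k2 := key c d hc.2 hd.2
  rw [norm_herm_comm d c] at k1
  refine absurd hdist (not_le.2 (dist_lt_log_three_of_distRatio_lt
    (z := d - herm d c • c) (w := c - herm c d • d)
    ((hc.1.2 _).2 ?_) ((hd.1.2 _).2 ?_) ?_ ?_ ?_))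
  · rw [herm_sub_right, herm_smul_right, conj_herm, hc.2]; ring
  · rw [herm_sub_right, herm_smul_right, conj_herm, hd.2]; ring
  · rw [IsNegative, k1]; linarith
  · rw [IsNegative, k2]; linarith
  · have e : herm (d - herm d c • c) (c - herm c d • d)
        = herm d c * ((‖herm c d‖ ^ 2 - 1 : ℝ) : ℂ) := by
      push_cast
      have := herm_mul_herm_swap c d
      push_cast at this
      simp only [herm_sub_left, herm_sub_right, herm_smul_left, herm_smul_right, conj_herm,
        hc.2, hd.2]
      rw [← this]
      ring
    have hne : 1 - ‖herm c d‖ ^ 2 ≠ 0 := by linarith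
    rw [distRatio, k1, k2, e, norm_mul, Complex.norm_real, Real.norm_eq_abs, mul_pow, sq_abs,
      norm_herm_comm d c]
    rw [show ‖herm c d‖ ^ 2 * (‖herm c d‖ ^ 2 - 1) ^ 2
        / ((1 - ‖herm c d‖ ^ 2) * (1 - ‖herm c d‖ ^ 2)) = ‖herm c d‖ ^ 2 by field_simp; ring]
    exact hlt

theorem ComplexGeodesic.IsPolar.exists_smul_eq {C : ComplexGeodesic} {c d : Vec}
    (hc : C.IsPolar c) (hd : C.IsPolar d) : ∃ a : ℂ, a ≠ 0 ∧ d = a • c := by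
  have c0 := hc.1.herm_self_ne_zero
  set w := d - (herm d c / herm c c) • c with hw
  have hw0 : w = 0 := by
    refine eq_zero_of_forall_herm_eq_zero fun z => ?_
    set y := z - (herm z c / herm c c) • c with hy
    have h1 : herm c y = 0 := herm_comm_eq_zero (herm_sub_proj c0)
    have h2 : herm d y = 0 := (hd.2 y).1 ((hc.2 y).2 h1)
    have h3 : herm w c = 0 := herm_sub_proj c0
    have : herm w y = 0 := by rw [hw, herm_sub_left, herm_smul_left, h1, h2]; ring
    rwa [hy, herm_sub_right, herm_smul_right, h3, mul_zero, sub_zero] at this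
  have e := sub_eq_zero.1 hw0
  refine ⟨_, ?_, e⟩
  intro h0
  rw [h0, zero_smul] at e
  exact hd.1.herm_self_ne_zero (by rw [e]; simp [herm])

/-! ### Eisenstein integers and planar rotations -/

/-- The ring `ℤ[ω]` of Eisenstein integers, for either primitive cube root of unity `ω`. -/
def eisenstein {ω : ℂ} (hω : ω ^ 2 + ω + 1 = 0) : Subring ℂ where
  carrier := {z | ∃ m n : ℤ, z = m + n * ω}
  one_mem' := ⟨1, 0, by simp⟩
  zero_mem' := ⟨0, 0, by simp⟩
  add_mem' := by
    rintro _ _ ⟨m, n, rfl⟩ ⟨m', n', rfl⟩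
    exact ⟨m + m', n + n', by push_cast; ring⟩
  neg_mem' := by
    rintro _ ⟨m, n, rfl⟩
    exact ⟨-m, -n, by push_cast; ring⟩
  mul_mem' := by
    rintro _ _ ⟨m, n, rfl⟩ ⟨m', n', rfl⟩
    refine ⟨m * m' - n * n', m * n' + n * m' - n * n', ?_⟩
    push_cast
    linear_combination n * n' * hω

section Eisenstein

variable {ω : ℂ} (hω : ω ^ 2 + ω + 1 = 0)

theorem omega_mem_eisenstein : ω ∈ eisenstein hω := ⟨0, 1, by simp⟩

theorem two_mem_eisenstein : (2 : ℂ) ∈ eisenstein hω := ⟨2, 0, by simp⟩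

include hω

theorem omega_re_im : ω.re = -1 / 2 ∧ ω.im ^ 2 = 3 / 4 := by
  have h1 := congrArg Complex.re hω
  have h2 := congrArg Complex.im hω
  simp [pow_two] at h1 h2
  have h3 : ω.im * (2 * ω.re + 1) = 0 := by linarith
  rcases mul_eq_zero.1 h3 with h | h
  · rw [h] at h1
    nlinarith [sq_nonneg (2 * ω.re + 1)]
  · have : ω.re = -1 / 2 := by linarith
    refine ⟨this, ?_⟩
    rw [this] at h1
    linarith

theorem norm_sq_omega_sub_one : ‖ω - 1‖ ^ 2 = 3 := by
  obtain ⟨h1, h2⟩ := omega_re_im hω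
  rw [← Complex.normSq_eq_norm_sq, Complex.normSq_apply]
  simp only [Complex.sub_re, Complex.sub_im, Complex.one_re, Complex.one_im, h1]
  nlinarith

theorem exists_norm_sq_eq_of_mem_eisenstein {z : ℂ} (hz : z ∈ eisenstein hω) :
    ∃ N : ℕ, ‖z‖ ^ 2 = N := by
  obtain ⟨m, n, rfl⟩ := hz
  obtain ⟨h1, h2⟩ := omega_re_im hω
  have e : ‖(m + n * ω : ℂ)‖ ^ 2 = ((m ^ 2 - m * n + n ^ 2 : ℤ) : ℝ) := by
    rw [← Complex.normSq_eq_norm_sq, Complex.normSq_apply]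
    simp only [Complex.add_re, Complex.add_im, Complex.mul_re, Complex.mul_im,
      Complex.intCast_re, Complex.intCast_im, h1]
    push_cast
    linear_combination (n : ℝ) ^ 2 * h2
  have h0 : 0 ≤ m ^ 2 - m * n + n ^ 2 := by nlinarith [sq_nonneg (m - n), sq_nonneg m, sq_nonneg n]
  refine ⟨(m ^ 2 - m * n + n ^ 2).toNat, ?_⟩
  rw [e, ← Int.cast_natCast, Int.toNat_of_nonneg h0]

theorem one_le_norm_sq_of_mem_eisenstein {z : ℂ} (hz : z ∈ eisenstein hω) (h : z ≠ 0) :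
    1 ≤ ‖z‖ ^ 2 := by
  obtain ⟨N, hN⟩ := exists_norm_sq_eq_of_mem_eisenstein hω hz
  have : 0 < ‖z‖ ^ 2 := by positivity
  rw [hN] at this ⊢
  exact_mod_cast this

/-- In the triangle with sides `u = 2a`, `v = (ω - 1)b` and `-(u + v)`, where `1 + u + v` is a unit
of `ℤ[ω]`, the angle opposite to `u + v` is at most `60°`. -/
theorem norm_sq_add_le {a b : ℂ} (ha : a ∈ eisenstein hω) (hb : b ∈ eisenstein hω)
    (a0 : a ≠ 0) (b0 : b ≠ 0) (h : ‖1 + 2 * a + (ω - 1) * b‖ = 1) :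
    ‖2 * a + (ω - 1) * b‖ ^ 2
      ≤ ‖2 * a‖ ^ 2 - ‖2 * a‖ * ‖(ω - 1) * b‖ + ‖(ω - 1) * b‖ ^ 2 := by
  obtain ⟨A, hA⟩ := exists_norm_sq_eq_of_mem_eisenstein hω ha
  obtain ⟨B, hB⟩ := exists_norm_sq_eq_of_mem_eisenstein hω hb
  have A1 : 1 ≤ A := by exact_mod_cast hA ▸ one_le_norm_sq_of_mem_eisenstein hω ha a0
  have B1 : 1 ≤ B := by exact_mod_cast hB ▸ one_le_norm_sq_of_mem_eisenstein hω hb b0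
  have hu : ‖2 * a‖ ^ 2 = 4 * A := by rw [norm_mul, mul_pow, hA]; norm_num
  have hv : ‖(ω - 1) * b‖ ^ 2 = 3 * B := by
    rw [norm_mul, mul_pow, hB, norm_sq_omega_sub_one hω]
  have hd : ‖2 * a + (ω - 1) * b‖ ≤ 2 := by
    have := norm_sub_le (1 + 2 * a + (ω - 1) * b) 1
    rw [h, norm_one] at this
    rw [show 2 * a + (ω - 1) * b = 1 + 2 * a + (ω - 1) * b - 1 by ring]
    linarith
  have hd2 : ‖2 * a + (ω - 1) * b‖ ^ 2 ≤ 4 := by nlinarith [norm_nonneg (2 * a + (ω - 1) * b)]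
  have u0 := norm_nonneg (2 * a)
  have v0 := norm_nonneg ((ω - 1) * b)
  generalize hU : ‖2 * a‖ = U at *
  generalize hV : ‖(ω - 1) * b‖ = V at *
  by_cases hA2 : 2 ≤ A
  · have : (2 : ℝ) ≤ A := by exact_mod_cast hA2
    nlinarith [sq_nonneg (U - 2 * V)]
  by_cases hB2 : 2 ≤ B
  · have : (2 : ℝ) ≤ B := by exact_mod_cast hB2
    nlinarith [sq_nonneg (V - 2 * U)]
  obtain rfl : A = 1 := by omega
  obtain rfl : B = 1 := by omega
  push_cast at hu hv
  -- the remaining case `|u| = 2`, `|v| = √3` needs `|u + v|² ≤ 3`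
  have hd3 : ‖2 * a + (ω - 1) * b‖ ^ 2 ≤ 3 := by
    obtain ⟨N, hN⟩ := exists_norm_sq_eq_of_mem_eisenstein hω
      (add_mem (mul_mem (two_mem_eisenstein hω) ha)
        (mul_mem (sub_mem (omega_mem_eisenstein hω) (one_mem _)) hb))
    rw [hN] at hd2 ⊢
    have N4 : N ≤ 4 := by exact_mod_cast hd2
    rcases N4.lt_or_eq with hlt | heq
    · exact_mod_cast Nat.le_of_lt_succ hlt
    · -- otherwise `1 + u + v = -1`, so that `v` would be divisible by `2`
      exfalso
      have e : 2 * a + (ω - 1) * b = -2 := by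
        have h1 : ‖1 + (2 * a + (ω - 1) * b)‖ ^ 2 = 1 := by rw [← add_assoc, h, one_pow]
        rw [heq] at hN
        rw [← Complex.normSq_eq_norm_sq, Complex.normSq_apply] at h1 hN
        simp only [Complex.add_re, Complex.add_im, Complex.one_re, Complex.one_im] at h1 hN
        push_cast at hN
        have hre : (2 * a + (ω - 1) * b).re = -2 := by
          simp only [Complex.add_re]; nlinarith
        have him : (2 * a + (ω - 1) * b).im = 0 := by
          have := hre
          simp only [Complex.add_re] at this
          simp only [Complex.add_im]; nlinarith
        exact Complex.ext (by simpa using hre) (by simpa using him)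
      have e' : (ω - 1) * b = 2 * (-1 - a) := by linear_combination e
      obtain ⟨M, hM⟩ := exists_norm_sq_eq_of_mem_eisenstein hω
        (sub_mem (neg_mem (one_mem (eisenstein hω))) ha)
      rw [← hV, e', norm_mul, mul_pow, hM] at hv
      norm_num at hv
      have : 4 * M = 3 := by exact_mod_cast hv
      omega
  nlinarith

end Eisenstein

/-- The product of two numbers in the sector of half-angle `60°` around the negative real axis has
argument at most `120°` in modulus. -/
theorem re_mul_ge_of_sector {p s : ℂ} (hp : p.re ≤ -(1 / 2) * ‖p‖) (hs : s.re ≤ -(1 / 2) * ‖s‖) :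
    -(1 / 2) * (‖p‖ * ‖s‖) ≤ (p * s).re := by
  have aux : ∀ z : ℂ, z.re ≤ -(1 / 2) * ‖z‖ → z.im ^ 2 ≤ 3 / 4 * ‖z‖ ^ 2 := by
    intro z hz
    have := Complex.normSq_eq_norm_sq z
    rw [Complex.normSq_apply] at this
    nlinarith [norm_nonneg z]
  have p0 := norm_nonneg p
  have s0 := norm_nonneg s
  have h1 : 1 / 4 * (‖p‖ * ‖s‖) ≤ p.re * s.re := by nlinarith
  have h2 : p.im * s.im ≤ 3 / 4 * (‖p‖ * ‖s‖) := by
    refine le_of_sq_le_sq ?_ (by positivity)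
    calc (p.im * s.im) ^ 2 = p.im ^ 2 * s.im ^ 2 := by ring
      _ ≤ (3 / 4 * ‖p‖ ^ 2) * (3 / 4 * ‖s‖ ^ 2) :=
        mul_le_mul (aux p hp) (aux s hs) (sq_nonneg _) (by positivity)
      _ = _ := by ring
  rw [Complex.mul_re]
  linarith

theorem two_le_norm_add_of_sector {u v x y : ℂ} (hu : 2 ≤ ‖u‖)
    (huv : ‖u + v‖ ^ 2 ≤ ‖u‖ ^ 2 - ‖u‖ * ‖v‖ + ‖v‖ ^ 2) (hx : 4 / 3 ≤ ‖x‖ ^ 2)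
    (hxy : (x * conj y).re ≤ -(1 / 2) * (‖x‖ * ‖y‖)) : 2 ≤ ‖u * x + v * y‖ := by
  have add_sq : ∀ z w : ℂ, ‖z + w‖ ^ 2 = ‖z‖ ^ 2 + ‖w‖ ^ 2 + 2 * (z * conj w).re := by
    intro z w
    simp only [← Complex.normSq_eq_norm_sq, Complex.normSq_add]
  have h1 : (u * conj v).re ≤ -(1 / 2) * ‖u * conj v‖ := by
    rw [norm_mul, Complex.norm_conj]
    rw [add_sq] at huv
    linarith
  have h2 : (x * conj y).re ≤ -(1 / 2) * ‖x * conj y‖ := by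
    rw [norm_mul, Complex.norm_conj]
    exact hxy
  have h3 := re_mul_ge_of_sector h1 h2
  have h4 := add_sq (u * x) (v * y)
  rw [show u * x * conj (v * y) = u * conj v * (x * conj y) by rw [map_mul]; ring] at h4
  simp only [norm_mul, Complex.norm_conj] at h3 h4
  have h5 : 16 / 3 ≤ (‖u‖ * ‖x‖) ^ 2 := by
    rw [mul_pow]
    nlinarith [norm_nonneg u, sq_nonneg ‖x‖]
  refine le_of_sq_le_sq ?_ (norm_nonneg _)
  nlinarith [sq_nonneg (‖u‖ * ‖x‖ - 2 * (‖v‖ * ‖y‖))]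

/-- The planar part of the argument: every nontrivial element of the group generated by
the rotations of orders two and three moves the origin by a distance of at least two. -/
theorem two_le_norm_eisenstein_combination {ω : ℂ} (hω : ω ^ 2 + ω + 1 = 0) {a b x y : ℂ}
    (ha : a ∈ eisenstein hω) (hb : b ∈ eisenstein hω) (hab : a ≠ 0 ∨ b ≠ 0)
    (h : ‖1 + 2 * a + (ω - 1) * b‖ = 1) (hx : 4 / 3 ≤ ‖x‖ ^ 2) (hy : 4 / 3 ≤ ‖y‖ ^ 2)
    (hxy : (x * conj y).re ≤ -(1 / 2) * (‖x‖ * ‖y‖)) :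
    2 ≤ ‖2 * a * x + (ω - 1) * b * y‖ := by
  have two_norm : ∀ {z : ℂ}, z ∈ eisenstein hω → z ≠ 0 → 4 ≤ ‖2 * z‖ ^ 2 := by
    intro z hz z0
    have := one_le_norm_sq_of_mem_eisenstein hω hz z0
    rw [norm_mul, mul_pow, Complex.norm_two]
    linarith
  by_cases a0 : a = 0
  · have b0 : b ≠ 0 := by simpa [a0] using hab
    have := one_le_norm_sq_of_mem_eisenstein hω hb b0
    rw [a0, mul_zero, zero_mul, zero_add]
    refine le_of_sq_le_sq ?_ (norm_nonneg _)
    rw [norm_mul, norm_mul, mul_pow, mul_pow, norm_sq_omega_sub_one hω]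
    nlinarith
  · have h2 := two_norm ha a0
    have h2' : 2 ≤ ‖2 * a‖ := by
      refine le_of_sq_le_sq ?_ (norm_nonneg _)
      linarith
    by_cases b0 : b = 0
    · rw [b0, mul_zero, zero_mul, add_zero]
      refine le_of_sq_le_sq ?_ (norm_nonneg _)
      rw [norm_mul, mul_pow]
      nlinarith
    · exact two_le_norm_add_of_sector h2' (norm_sq_add_le hω ha hb a0 b0 h) hx hxy

/-! ### The stabiliser of the common boundary point -/

theorem linearIndependent_of_herm_eq {q c d : Vec} (hq : herm q q = 0) (hqc : herm q c = 0)
    (hc : herm c c = 1) (hqd : herm q d = 1) : LinearIndependent ℂ ![q, c, d] := by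
  rw [Fintype.linearIndependent_iff]
  intro g hg
  simp only [Fin.sum_univ_three, Matrix.cons_val_zero, Matrix.cons_val_one, Matrix.cons_val] at hg
  have hcq := herm_comm_eq_zero hqc
  have hdq : herm d q = 1 := by rw [← conj_herm, hqd, map_one]
  have key : ∀ w, g 0 * herm q w + g 1 * herm c w + g 2 * herm d w = 0 := by
    intro w
    rw [← herm_smul_left, ← herm_smul_left, ← herm_smul_left, ← herm_add_left, ← herm_add_left, hg]
    simp [herm]
  have h2 : g 2 = 0 := by simpa [hq, hcq, hdq] using key q
  have h1 : g 1 = 0 := by simpa [h2, hqc, hc] using key c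
  have h0 : g 0 = 0 := by simpa [h2, h1, hqd] using key d
  intro i
  fin_cases i
  · exact h0
  · exact h1
  · exact h2

theorem eq_smul_of_orthogonal {q c d x : Vec} (hq : herm q q = 0) (hqc : herm q c = 0)
    (hc : herm c c = 1) (hqd : herm q d = 1) (hxq : herm x q = 0) (hxc : herm x c = 0) :
    x = herm x d • q := by
  refine sub_eq_zero.1 (eq_zero_of_forall_herm_eq_zero fun z => ?_)
  have hz : z ∈ Submodule.span ℂ (Set.range ![q, c, d]) := by
    rw [(linearIndependent_of_herm_eq hq hqc hc hqd).span_eq_top_of_card_eq_finrank' (by simp)]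
    trivial
  induction hz using Submodule.span_induction with
  | mem y hy =>
    obtain ⟨i, rfl⟩ := hy
    rw [herm_sub_left, herm_smul_left]
    fin_cases i
    · simp [hxq, hq]
    · simp [hxc, hqc]
    · simp [hqd]
  | zero => simp [herm]
  | add y z _ _ hy hz => rw [herm_add_right, hy, hz, add_zero]
  | smul a y _ hy => rw [herm_smul_right, hy, mul_zero]

/-- The linear action of `U(2,1)` on `ℂ^{2,1}`. -/
noncomputable def act : U21 →* Module.End ℂ Vec where
  toFun A := Matrix.mulVecLin A.1.1
  map_one' := Matrix.mulVecLin_one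
  map_mul' A B := Matrix.mulVecLin_mul A.1.1 B.1.1

theorem act_apply (A : U21) (z : Vec) : act A z = A.1.1 *ᵥ z := rfl

theorem herm_act (A : U21) (z w : Vec) : herm (act A z) (act A w) = herm z w := A.2 z w

theorem act_mul_apply (A B : U21) (z : Vec) : act (A * B) z = act A (act B z) := by
  rw [map_mul, Module.End.mul_apply]

theorem act_inv_apply (A : U21) (z : Vec) : act A⁻¹ (act A z) = z := by
  rw [← act_mul_apply, inv_mul_cancel, map_one, Module.End.one_apply]

theorem eq_one_of_act_eq_one {A : U21} (h : act A = 1) : A = 1 := by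
  refine Subtype.ext (Units.ext ?_)
  have : Matrix.toLin' A.1.1 = Matrix.toLin' 1 := by
    rw [Matrix.toLin'_one]; exact h
  exact Matrix.toLin'.injective this

/-- The complex reflection with normalised polar vector `c` and multiplier `μ`, lifted to the
unitary map fixing the mirror pointwise. -/
noncomputable def reflection (μ : ℂ) (c z : Vec) : Vec := z + ((μ - 1) * herm z c) • c

theorem reflection_reflection {c : Vec} (hc : herm c c = 1) (μ ν : ℂ) (z : Vec) :
    reflection μ c (reflection ν c z) = reflection (μ * ν) c z := by
  simp only [reflection, herm_add_left, herm_smul_left, hc]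
  module

/-- Two asymptotic complex geodesics with polar vectors `c₁` and `c₂ = c₁ + βq`, whose common
boundary point is the line of `q`, and a third one with polar vector `c₃`, scaled such that
`⟨q, c₃⟩ = 1`, together with lifts of complex reflections of orders `2`, `3` and `2` that fix their
mirrors pointwise. In Heisenberg coordinates based at `q`, the geodesics with polar vectors
`c₁`, `c₂` are vertical chains at the positions `x₁ = ⟨c₁, c₃⟩`, `x₂ = ⟨c₂, c₃⟩` in the plane. -/
structure AsymptoticTriangle where
  q : Vec
  c₁ : Vec
  c₃ : Vec
  β : ℂ
  ω : ℂ
  A₁ : U21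
  A₂ : U21
  A₃ : U21
  herm_q_q : herm q q = 0
  herm_q_c₁ : herm q c₁ = 0
  herm_c₁_c₁ : herm c₁ c₁ = 1
  herm_q_c₃ : herm q c₃ = 1
  herm_c₃_c₃ : herm c₃ c₃ = 1
  omega_eq : ω ^ 2 + ω + 1 = 0
  act_A₁ : ∀ z, act A₁ z = reflection (-1) c₁ z
  act_A₂ : ∀ z, act A₂ z = reflection ω (c₁ + β • q) z
  act_A₃ : ∀ z, act A₃ z = reflection (-1) c₃ z
  le_x₁ : 4 / 3 ≤ ‖herm c₁ c₃‖ ^ 2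
  le_x₂ : 4 / 3 ≤ ‖herm c₁ c₃ + β‖ ^ 2
  angle : (herm c₁ c₃ * conj (herm c₁ c₃ + β)).re
    ≤ -(1 / 2) * (‖herm c₁ c₃‖ * ‖herm c₁ c₃ + β‖)

namespace AsymptoticTriangle

variable (T : AsymptoticTriangle)

theorem herm_c₁_q : herm T.c₁ T.q = 0 := herm_comm_eq_zero T.herm_q_c₁

theorem herm_c₃_q : herm T.c₃ T.q = 1 := by rw [← conj_herm, T.herm_q_c₃, map_one]

theorem q_ne_zero : T.q ≠ 0 := by
  intro h
  have := T.herm_q_c₃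
  rw [h] at this
  simp [herm] at this

/-- The image of `q` under the third reflection. -/
noncomputable def q₀ : Vec := T.q - (2 : ℂ) • T.c₃

theorem act_A₃_q : act T.A₃ T.q = T.q₀ := by
  rw [T.act_A₃, reflection, T.herm_q_c₃, q₀]
  module

theorem act_A₃_q₀ : act T.A₃ T.q₀ = T.q := by
  rw [T.act_A₃, reflection, q₀, herm_sub_left, herm_smul_left, T.herm_q_c₃, T.herm_c₃_c₃]
  module

theorem herm_q₀_q : herm T.q₀ T.q = -2 := by
  rw [q₀, herm_sub_left, herm_smul_left, T.herm_q_q, T.herm_c₃_q]; ring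

theorem herm_q₀_q₀ : herm T.q₀ T.q₀ = 0 := by
  rw [← T.act_A₃_q, herm_act, T.herm_q_q]

theorem herm_q₀_c₁ : herm T.q₀ T.c₁ = -2 * conj (herm T.c₁ T.c₃) := by
  rw [q₀, herm_sub_left, herm_smul_left, T.herm_q_c₁, conj_herm]; ring

theorem eq_one_of_fixes {A : U21} (h1 : act A T.q = T.q) (h2 : act A T.c₁ = T.c₁)
    (h3 : act A T.q₀ = T.q₀) : A = 1 := by
  apply eq_one_of_act_eq_one
  have e : T.c₃ = (1 / 2 : ℂ) • (T.q - T.q₀) := by rw [q₀]; module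
  refine LinearMap.ext_on ((linearIndependent_of_herm_eq T.herm_q_q T.herm_q_c₁ T.herm_c₁_c₁
    T.herm_q_c₃).span_eq_top_of_card_eq_finrank' (by simp)) ?_
  rintro _ ⟨i, rfl⟩
  fin_cases i
  · exact h1
  · exact h2
  · change act A T.c₃ = T.c₃
    rw [e, map_smul, map_sub, h1, h3]

/-- The component of `q₀` orthogonal to `c₁`. -/
noncomputable def n : Vec := T.q₀ + (2 * conj (herm T.c₁ T.c₃)) • T.c₁

theorem herm_n_q : herm T.n T.q = -2 := by
  rw [n, herm_add_left, herm_smul_left, T.herm_q₀_q, T.herm_c₁_q]; ring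

theorem herm_n_c₁ : herm T.n T.c₁ = 0 := by
  rw [n, herm_add_left, herm_smul_left, T.herm_q₀_c₁, T.herm_c₁_c₁]; ring

theorem act_A₁_q : act T.A₁ T.q = T.q := by
  rw [T.act_A₁, reflection, T.herm_q_c₁]; module

theorem act_A₁_c₁ : act T.A₁ T.c₁ = -T.c₁ := by
  rw [T.act_A₁, reflection, T.herm_c₁_c₁]; module

theorem act_A₁_n : act T.A₁ T.n = T.n := by
  rw [T.act_A₁, reflection, T.herm_n_c₁]; module

theorem act_A₂_q : act T.A₂ T.q = T.q := by
  rw [T.act_A₂, reflection, herm_add_right, herm_smul_right, T.herm_q_c₁, T.herm_q_q]; module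

theorem act_A₂_c₁ : act T.A₂ T.c₁ = T.ω • T.c₁ + ((T.ω - 1) * T.β) • T.q := by
  rw [T.act_A₂, reflection, herm_add_right, herm_smul_right, T.herm_c₁_c₁, T.herm_c₁_q]; module

theorem act_A₂_n : act T.A₂ T.n
    = T.n - (2 * conj T.β * (T.ω - 1)) • T.c₁ - (2 * conj T.β * T.β * (T.ω - 1)) • T.q := by
  rw [T.act_A₂, reflection, herm_add_right, herm_smul_right, T.herm_n_c₁, T.herm_n_q]; module

theorem inv_A₁ : T.A₁⁻¹ = T.A₁ := by
  rw [inv_eq_iff_mul_eq_one]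
  refine eq_one_of_act_eq_one (LinearMap.ext fun z => ?_)
  rw [act_mul_apply, T.act_A₁, T.act_A₁, reflection_reflection T.herm_c₁_c₁, reflection,
    Module.End.one_apply]
  module

theorem inv_A₂ : T.A₂⁻¹ = T.A₂ * T.A₂ := by
  rw [inv_eq_iff_mul_eq_one]
  refine eq_one_of_act_eq_one (LinearMap.ext fun z => ?_)
  have hc : herm (T.c₁ + T.β • T.q) (T.c₁ + T.β • T.q) = 1 := by
    simp only [herm_add_left, herm_add_right, herm_smul_left, herm_smul_right, T.herm_q_c₁,
      T.herm_c₁_q, T.herm_q_q, T.herm_c₁_c₁]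
    ring
  rw [act_mul_apply, act_mul_apply, T.act_A₂, T.act_A₂, T.act_A₂, reflection_reflection hc,
    reflection_reflection hc, reflection, Module.End.one_apply,
    show T.ω * T.ω * T.ω - 1 = (T.ω - 1) * (T.ω ^ 2 + T.ω + 1) by ring, T.omega_eq]
  module

theorem inv_A₃ : T.A₃⁻¹ = T.A₃ := by
  rw [inv_eq_iff_mul_eq_one]
  refine eq_one_of_act_eq_one (LinearMap.ext fun z => ?_)
  rw [act_mul_apply, T.act_A₃, T.act_A₃, reflection_reflection T.herm_c₃_c₃, reflection,
    Module.End.one_apply]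
  module

/-- The subgroup generated by the reflections in the two asymptotic geodesics. -/
def stabiliser : Subgroup U21 := Subgroup.closure {T.A₁, T.A₂}

/-- The shape of the elements of `T.stabiliser` with respect to the basis `q, c₁, n`. The unit
`1 + 2a + (ω - 1)b` of `ℤ[ω]` is the rotational part of the action on the plane, `(ω - 1)bβ` the
translational part, and the last coordinate `s` contains the vertical displacement. -/
def IsEisenstein (A : U21) : Prop :=
  act A T.q = T.q ∧ ∃ a ∈ eisenstein T.omega_eq, ∃ b ∈ eisenstein T.omega_eq,
    ∃ η ∈ eisenstein T.omega_eq, ∃ s ∈ eisenstein T.omega_eq,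
    act A T.c₁ = (1 + 2 * a + (T.ω - 1) * b) • T.c₁ + ((T.ω - 1) * b * T.β) • T.q ∧
    act A T.n = T.n + (2 * conj T.β * η) • T.c₁ + (conj T.β * T.β * s) • T.q

variable {T}

theorem isEisenstein_one : T.IsEisenstein 1 := by
  refine ⟨by simp, 0, zero_mem _, 0, zero_mem _, 0, zero_mem _, 0, zero_mem _, ?_, ?_⟩
  · rw [map_one, Module.End.one_apply]; module
  · rw [map_one, Module.End.one_apply]; module

theorem IsEisenstein.A₁_mul {A : U21} (h : T.IsEisenstein A) : T.IsEisenstein (T.A₁ * A) := by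
  obtain ⟨hq, a, ha, b, hb, η, hη, s, hs, h1, h2⟩ := h
  have hω := sub_mem (omega_mem_eisenstein T.omega_eq) (one_mem _)
  refine ⟨by rw [act_mul_apply, hq, T.act_A₁_q], -1 - a - (T.ω - 1) * b,
    sub_mem (sub_mem (neg_mem (one_mem _)) ha) (mul_mem hω hb), b, hb, -η, neg_mem hη, s, hs,
    ?_, ?_⟩
  · rw [act_mul_apply, h1, map_add, map_smul, map_smul, T.act_A₁_q, T.act_A₁_c₁]
    module
  · rw [act_mul_apply, h2, map_add, map_add, map_smul, map_smul, T.act_A₁_q, T.act_A₁_c₁,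
      T.act_A₁_n]
    module

theorem IsEisenstein.A₂_mul {A : U21} (h : T.IsEisenstein A) : T.IsEisenstein (T.A₂ * A) := by
  obtain ⟨hq, a, ha, b, hb, η, hη, s, hs, h1, h2⟩ := h
  have hω := sub_mem (omega_mem_eisenstein T.omega_eq) (one_mem _)
  have h2' := two_mem_eisenstein T.omega_eq
  refine ⟨by rw [act_mul_apply, hq, T.act_A₂_q], a, ha, 1 + 2 * a + (T.ω - 1) * b + b,
    add_mem (add_mem (add_mem (one_mem _) (mul_mem h2' ha)) (mul_mem hω hb)) hb,
    T.ω * η - (T.ω - 1), sub_mem (mul_mem (omega_mem_eisenstein _) hη) hω,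
    s - 2 * (T.ω - 1) + 2 * η * (T.ω - 1),
    add_mem (sub_mem hs (mul_mem h2' hω)) (mul_mem (mul_mem h2' hη) hω), ?_, ?_⟩
  · rw [act_mul_apply, h1, map_add, map_smul, map_smul, T.act_A₂_q, T.act_A₂_c₁]
    module
  · rw [act_mul_apply, h2, map_add, map_add, map_smul, map_smul, T.act_A₂_q, T.act_A₂_c₁,
      T.act_A₂_n]
    module

theorem isEisenstein_of_mem_stabiliser {A : U21} (hA : A ∈ T.stabiliser) : T.IsEisenstein A := by
  induction hA using Subgroup.closure_induction_left with
  | one => exact isEisenstein_one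
  | mul_left x hx y hy h =>
    rcases hx with rfl | rfl
    · exact h.A₁_mul
    · exact h.A₂_mul
  | inv_mul_cancel x hx y hy h =>
    rcases hx with rfl | rfl
    · rw [T.inv_A₁]; exact h.A₁_mul
    · rw [T.inv_A₂, mul_assoc]; exact h.A₂_mul.A₂_mul

theorem four_le_norm_beta_sq : 4 ≤ ‖T.β‖ ^ 2 := by
  have e : ‖T.β‖ ^ 2 = ‖herm T.c₁ T.c₃‖ ^ 2 + ‖herm T.c₁ T.c₃ + T.β‖ ^ 2
      - 2 * (herm T.c₁ T.c₃ * conj (herm T.c₁ T.c₃ + T.β)).re := by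
    have : T.β = (herm T.c₁ T.c₃ + T.β) - herm T.c₁ T.c₃ := by ring
    simp only [← Complex.normSq_eq_norm_sq]
    rw [this, ← Complex.normSq_neg, neg_sub, Complex.normSq_sub, add_sub_cancel]
  have h1 := T.le_x₁
  have h2 := T.le_x₂
  have h3 := T.angle
  have : 4 / 3 ≤ ‖herm T.c₁ T.c₃‖ * ‖herm T.c₁ T.c₃ + T.β‖ := by
    refine le_of_sq_le_sq ?_ (by positivity)
    rw [mul_pow]
    nlinarith
  linarith

/-- In Heisenberg coordinates, two points at Cygan distance at most one from the same point of the
complex hyperbolic plane have planar distance less than two. The normalisation `⟨·, q⟩ = -2` of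
their representatives doubles the planar distance, whence the bound `16 = 4²`. -/
theorem re_herm_sub_self_lt_sixteen {z p r : Vec} (nz : IsNegative z) (hz : herm z T.q = 1)
    (hp : herm p p = 0) (hpq : herm p T.q = -2) (hr : herm r r = 0) (hrq : herm r T.q = -2)
    (h1 : ‖herm z p‖ ≤ 1) (h2 : ‖herm z r‖ ≤ 1) : (herm (r - p) (r - p)).re < 16 := by
  have nz' : (herm z z).re < 0 := nz
  have half : ∀ y : Vec, herm y y = 0 → (herm (z + (1 / 2 : ℂ) • y) (z + (1 / 2 : ℂ) • y)).re
      = (herm z z).re + (herm z y).re := by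
    intro y hy
    have := re_herm_sub_smul z y (-(1 / 2))
    rw [neg_smul, sub_neg_eq_add] at this
    rw [this, hy]
    simp
  have e1 := half p hp
  have e2 := half r hr
  have k1 := (Complex.re_le_norm _).trans h1
  have k2 := (Complex.re_le_norm _).trans h2
  set x := z + (1 / 2 : ℂ) • p with hx
  set y := z + (1 / 2 : ℂ) • r with hy
  have hpos : 0 ≤ (herm (x + y) (x + y)).re := by
    refine re_herm_self_nonneg T.q_ne_zero (by rw [T.herm_q_q]; simp) ?_
    rw [hx, hy]
    simp only [herm_add_left, herm_smul_left, hz, hpq, hrq]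
    norm_num
  have hpar : herm (r - p) (r - p)
      = (4 : ℝ) * (2 * herm x x + 2 * herm y y - herm (x + y) (x + y)) := by
    have : r - p = (2 : ℂ) • (y - x) := by rw [hx, hy]; module
    rw [this]
    simp only [herm_add_left, herm_add_right, herm_sub_left, herm_sub_right, herm_smul_left,
      herm_smul_right, map_ofNat]
    push_cast
    ring
  rw [hpar, Complex.re_ofReal_mul]
  simp only [Complex.add_re, Complex.sub_re, Complex.mul_re, Complex.re_ofNat, Complex.im_ofNat,
    zero_mul, sub_zero]
  linarith

/-- The planar displacement of `q₀`, read off from the image of `c₁`. -/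
theorem norm_herm_act_sub_c₁ {A : U21} (hq : act A T.q = T.q) {l k : ℂ}
    (hc : act A T.c₁ = l • T.c₁ + (k * T.β) • T.q) :
    ‖l‖ = 1 ∧ ‖herm (act A T.q₀ - T.q₀) T.c₁‖
      = 2 * ‖(l - 1 - k) * herm T.c₁ T.c₃ + k * (herm T.c₁ T.c₃ + T.β)‖ := by
  have hl : ‖l‖ = 1 := by
    have h := herm_act A T.c₁ T.c₁
    rw [hc] at h
    simp only [herm_add_left, herm_add_right, herm_smul_left, herm_smul_right, T.herm_q_c₁,
      T.herm_c₁_q, T.herm_q_q, T.herm_c₁_c₁, mul_zero, add_zero, mul_one] at h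
    have h' := congrArg norm h
    rw [norm_mul, Complex.norm_conj, norm_one] at h'
    nlinarith [norm_nonneg l]
  refine ⟨hl, ?_⟩
  have h := herm_act A T.q₀ T.c₁
  have h' : herm (act A T.q₀) T.q = -2 := by
    rw [← T.herm_q₀_q, ← herm_act A T.q₀ T.q, hq]
  rw [hc, herm_add_right, herm_smul_right, herm_smul_right, h', T.herm_q₀_c₁] at h
  have e : conj l * herm (act A T.q₀ - T.q₀) T.c₁
      = 2 * conj ((l - 1 - k) * herm T.c₁ T.c₃ + k * (herm T.c₁ T.c₃ + T.β)) := by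
    rw [herm_sub_left, T.herm_q₀_c₁]
    simp only [map_add, map_sub, map_mul, map_one] at h ⊢
    linear_combination h
  have := congrArg norm e
  rwa [norm_mul, norm_mul, Complex.norm_conj, Complex.norm_conj, hl, one_mul,
    Complex.norm_two] at this

/-- The unit Cygan ball around `q₀` is disjoint from its images under the nontrivial elements of
`T.stabiliser`. -/
theorem IsEisenstein.eq_one_of_herm_eq_one {A : U21} (hA : T.IsEisenstein A) {z : Vec}
    (nz : IsNegative z) (hz : herm z T.q = 1) (h1 : ‖herm z T.q₀‖ ≤ 1)
    (h2 : ‖herm z (act A T.q₀)‖ ≤ 1) : A = 1 := by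
  obtain ⟨hq, a, ha, b, hb, η, hη, s, hs, hc, hn⟩ := hA
  have hq₀q : herm (act A T.q₀) T.q = -2 := by
    rw [← T.herm_q₀_q, ← herm_act A T.q₀ T.q, hq]
  obtain ⟨hl, hν⟩ := norm_herm_act_sub_c₁ hq hc
  by_cases hab : a ≠ 0 ∨ b ≠ 0
  · exfalso
    have h3 := two_le_norm_eisenstein_combination T.omega_eq ha hb hab hl T.le_x₁ T.le_x₂ T.angle
    rw [show 1 + 2 * a + (T.ω - 1) * b - 1 - (T.ω - 1) * b = 2 * a by ring] at hν
    have h4 := re_herm_sub_self_lt_sixteen nz hz T.herm_q₀_q₀ T.herm_q₀_q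
      (by rw [herm_act, T.herm_q₀_q₀]) hq₀q h1 h2
    set w := act A T.q₀ - T.q₀ with hw
    have h5 := re_herm_self_nonneg (x := w - (herm w T.c₁ / herm T.c₁ T.c₁) • T.c₁) T.q_ne_zero
      (by rw [T.herm_q_q]; simp) (by
        rw [herm_sub_left, herm_smul_left, T.herm_c₁_q, hw, herm_sub_left, hq₀q, T.herm_q₀_q]
        ring)
    rw [re_herm_sub_proj (by rw [T.herm_c₁_c₁]; exact one_ne_zero), T.herm_c₁_c₁,
      Complex.one_re, div_one, hν] at h5
    nlinarith
  · -- a vertical translation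
    push Not at hab
    obtain ⟨rfl, rfl⟩ := hab
    have hβ := four_le_norm_beta_sq (T := T)
    have hβ0 : T.β ≠ 0 := by
      intro h
      rw [h, norm_zero] at hβ
      norm_num at hβ
    have hc' : act A T.c₁ = T.c₁ := by rw [hc]; module
    have hη0 : η = 0 := by
      have h := herm_act A T.n T.c₁
      rw [hc', hn] at h
      simpa [herm_add_left, herm_smul_left, T.herm_n_c₁, T.herm_c₁_c₁, T.herm_q_c₁, hβ0] using h
    have hq₀ : act A T.q₀ = T.q₀ + (conj T.β * T.β * s) • T.q := by
      have e : T.q₀ = T.n - (2 * conj (herm T.c₁ T.c₃)) • T.c₁ := by rw [n]; module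
      rw [e, map_sub, map_smul, hn, hc', hη0]
      module
    by_cases hs0 : s = 0
    · refine T.eq_one_of_fixes hq hc' ?_
      rw [hq₀, hs0]
      module
    · exfalso
      have h3 := one_le_norm_sq_of_mem_eisenstein T.omega_eq hs hs0
      have h4 : 1 ≤ ‖s‖ := by nlinarith [norm_nonneg s]
      rw [hq₀, herm_add_right, herm_smul_right, hz, mul_one] at h2
      have h5 : ‖conj (conj T.β * T.β * s)‖ ≤ 2 := by
        have := norm_sub_le (herm z T.q₀ + conj (conj T.β * T.β * s)) (herm z T.q₀)
        rw [add_sub_cancel_left] at this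
        linarith
      rw [Complex.norm_conj, norm_mul, norm_mul, Complex.norm_conj] at h5
      nlinarith

theorem herm_q_ne_zero {z : Vec} (nz : IsNegative z) : herm z T.q ≠ 0 := fun h =>
  absurd (re_herm_self_nonneg T.q_ne_zero (by rw [T.herm_q_q]; simp) h) (not_le.2 nz)

theorem IsEisenstein.eq_one {A : U21} (hA : T.IsEisenstein A) {z : Vec}
    (nz : IsNegative z) (h1 : ‖herm z T.q₀‖ ≤ ‖herm z T.q‖)
    (h2 : ‖herm z (act A T.q₀)‖ ≤ ‖herm z T.q‖) : A = 1 := by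
  have h0 := herm_q_ne_zero (T := T) nz
  have hpos : 0 < ‖herm z T.q‖ := norm_pos_iff.2 h0
  refine hA.eq_one_of_herm_eq_one (z := (herm z T.q)⁻¹ • z)
    ((isNegative_smul (inv_ne_zero h0)).2 nz) ?_ ?_ ?_
  · rw [herm_smul_left, inv_mul_cancel₀ h0]
  · rwa [herm_smul_left, norm_mul, norm_inv, inv_mul_le_iff₀ hpos, mul_one]
  · rwa [herm_smul_left, norm_mul, norm_inv, inv_mul_le_iff₀ hpos, mul_one]

end AsymptoticTriangle

/-! ### Ping-pong -/

namespace AsymptoticTriangle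

variable (T : AsymptoticTriangle)

/-- The vector `z` represents a point of the closed unit Cygan ball around `q₀`, which is bounded
by the isometric sphere of the third reflection. -/
def InBall (z : Vec) : Prop := ‖herm z T.q₀‖ ≤ ‖herm z T.q‖

/-- The vector `z` represents a point of a horoball at `q` that does not meet the unit Cygan ball
around `q₀`. -/
def InHoroball (z : Vec) : Prop := (herm z z).re < -‖herm z T.q‖ ^ 2

/-- The group generated by the three reflections. -/
def group : Subgroup U21 := Subgroup.closure {T.A₁, T.A₂, T.A₃}

/-- A neighbourhood of `1` in `U(2,1)`, invariant under scalars, that meets `T.group` trivially: its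
elements map a point of the horoball into the horoball, and a point of the open unit Cygan ball
around `q₀` into that ball. -/
def identityNhd : Set U21 :=
  {A | T.InHoroball (act A (T.q₀ + (2 : ℂ) • T.q)) ∧
    ‖herm (act A (T.q₀ + (1 / 2 : ℂ) • T.q)) T.q₀‖
      < ‖herm (act A (T.q₀ + (1 / 2 : ℂ) • T.q)) T.q‖}

variable {T}

theorem InHoroball.isNegative {z : Vec} (h : T.InHoroball z) : IsNegative z :=
  lt_of_lt_of_le h (neg_nonpos.2 (sq_nonneg _))

theorem InHoroball.not_inBall {z : Vec} (h : T.InHoroball z) : ¬ T.InBall z := by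
  intro hb
  rw [InHoroball] at h
  rw [InBall] at hb
  have h1 := re_herm_self_nonneg (x := z - (-(herm z T.q / 2)) • T.q₀) T.q_ne_zero
    (by rw [T.herm_q_q]; simp) (by rw [herm_sub_left, herm_smul_left, T.herm_q₀_q]; ring)
  rw [re_herm_sub_smul, T.herm_q₀_q₀, Complex.zero_re, mul_zero, add_zero] at h1
  have h2 := (abs_le.1 (Complex.abs_re_le_norm
    (conj (-(herm z T.q / 2)) * herm z T.q₀))).1
  rw [norm_mul, Complex.norm_conj, norm_neg, norm_div, Complex.norm_two] at h2
  nlinarith [norm_nonneg (herm z T.q)]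

theorem act_q_of_mem_stabiliser {g : U21} (hg : g ∈ T.stabiliser) : act g T.q = T.q :=
  (isEisenstein_of_mem_stabiliser hg).1

theorem herm_act_q {g : U21} (hg : g ∈ T.stabiliser) (z : Vec) :
    herm (act g z) T.q = herm z T.q := by
  rw [← herm_act g z T.q, act_q_of_mem_stabiliser hg]

theorem isNegative_act (A : U21) {z : Vec} : IsNegative (act A z) ↔ IsNegative z := by
  rw [IsNegative, IsNegative, herm_act]

theorem InHoroball.act_mem {g : U21} (hg : g ∈ T.stabiliser) {z : Vec} (h : T.InHoroball z) :
    T.InHoroball (act g z) := by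
  rw [InHoroball] at h ⊢
  rwa [herm_act, herm_act_q hg]

theorem eq_one_of_inBall {g : U21} (hg : g ∈ T.stabiliser) {z : Vec} (nz : IsNegative z)
    (h : T.InBall z) (h' : T.InBall (act g z)) : g = 1 := by
  refine (isEisenstein_of_mem_stabiliser hg).eq_one ((isNegative_act g).2 nz) h' ?_
  rw [herm_act, herm_act_q hg]
  exact h

theorem inBall_act_A₃ {z : Vec} (h : ¬ T.InBall z) : T.InBall (act T.A₃ z) := by
  rw [InBall, not_le] at h
  have h1 := herm_act T.A₃ z T.q
  have h2 := herm_act T.A₃ z T.q₀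
  rw [T.act_A₃_q] at h1
  rw [T.act_A₃_q₀] at h2
  rw [InBall, h1, h2]
  exact h.le

/-- Reduced alternating words in the elements of `T.stabiliser` and the third reflection. The
condition on the horoball in `mul` replaces the reducedness: it says that the remaining word does
not begin with the third reflection. -/
inductive IsReducedWord (T : AsymptoticTriangle) : U21 → Prop
  | of_mem {g : U21} : g ∈ T.stabiliser → IsReducedWord T g
  | mul {g A : U21} : g ∈ T.stabiliser → IsReducedWord T A →
      (∀ z, T.InHoroball z → ¬ T.InBall (act A z)) →
      IsReducedWord T (g * T.A₃ * A)

theorem IsReducedWord.mul_left {g A : U21} (hg : g ∈ T.stabiliser) (hA : T.IsReducedWord A) :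
    T.IsReducedWord (g * A) := by
  cases hA with
  | of_mem h => exact .of_mem (mul_mem hg h)
  | mul hg' hA hz =>
    rw [← mul_assoc, ← mul_assoc]
    exact .mul (mul_mem hg hg') hA hz

theorem IsReducedWord.A₃_mul {A : U21} (hA : T.IsReducedWord A) :
    T.IsReducedWord (T.A₃ * A) := by
  cases hA with
  | of_mem h =>
    rw [← one_mul T.A₃]
    exact .mul (one_mem _) (.of_mem h) fun z hz => (hz.act_mem h).not_inBall
  | @mul g B hg hB hz =>
    by_cases g1 : g = 1
    · rw [g1, one_mul, ← mul_assoc, inv_eq_iff_mul_eq_one.1 T.inv_A₃, one_mul]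
      exact hB
    · nth_rw 1 [← one_mul T.A₃]
      refine .mul (one_mem _) (.mul hg hB hz) fun z hz' hb => g1 ?_
      rw [act_mul_apply, act_mul_apply] at hb
      refine eq_one_of_inBall hg ?_ (inBall_act_A₃ (hz z hz')) hb
      exact (isNegative_act _).2 ((isNegative_act _).2 hz'.isNegative)

theorem isReducedWord_of_mem_group {A : U21} (hA : A ∈ T.group) : T.IsReducedWord A := by
  have h1 : T.A₁ ∈ T.stabiliser := Subgroup.subset_closure (by simp)
  have h2 : T.A₂ ∈ T.stabiliser := Subgroup.subset_closure (by simp)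
  induction hA using Subgroup.closure_induction_left with
  | one => exact .of_mem (one_mem _)
  | mul_left x hx y hy h =>
    rcases hx with rfl | rfl | rfl
    · exact h.mul_left h1
    · exact h.mul_left h2
    · exact h.A₃_mul
  | inv_mul_cancel x hx y hy h =>
    rcases hx with rfl | rfl | rfl
    · exact h.mul_left (inv_mem h1)
    · exact h.mul_left (inv_mem h2)
    · rw [T.inv_A₃]; exact h.A₃_mul

theorem mem_stabiliser_of_inHoroball {A : U21} (hA : A ∈ T.group) {z : Vec}
    (hz : T.InHoroball z) (h : T.InHoroball (act A z)) : A ∈ T.stabiliser := by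
  cases isReducedWord_of_mem_group hA with
  | of_mem h => exact h
  | @mul g B hg hB hB' =>
    exfalso
    have h' := h.act_mem (inv_mem hg)
    rw [mul_assoc, act_mul_apply, act_inv_apply, act_mul_apply] at h'
    exact h'.not_inBall (inBall_act_A₃ (hB' z hz))

theorem herm_q_q₀ : herm T.q T.q₀ = -2 := by
  rw [← conj_herm, T.herm_q₀_q, map_neg, map_ofNat]

theorem herm_basePoint (t : ℝ) :
    (herm (T.q₀ + (t : ℂ) • T.q) (T.q₀ + (t : ℂ) • T.q)).re = -4 * t ∧
    ‖herm (T.q₀ + (t : ℂ) • T.q) T.q‖ = 2 ∧ ‖herm (T.q₀ + (t : ℂ) • T.q) T.q₀‖ = 2 * |t| := by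
  refine ⟨?_, ?_, ?_⟩
  · have : herm (T.q₀ + (t : ℂ) • T.q) (T.q₀ + (t : ℂ) • T.q) = ((-4 * t : ℝ) : ℂ) := by
      simp only [herm_add_left, herm_add_right, herm_smul_left, herm_smul_right, T.herm_q₀_q,
        T.herm_q₀_q₀, T.herm_q_q, T.herm_q_q₀, Complex.conj_ofReal]
      push_cast
      ring
    rw [this, Complex.ofReal_re]
  · rw [herm_add_left, herm_smul_left, T.herm_q₀_q, T.herm_q_q]; simp
  · rw [herm_add_left, herm_smul_left, T.herm_q₀_q₀, T.herm_q_q₀]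
    simp [mul_comm]

theorem inHoroball_basePoint : T.InHoroball (T.q₀ + (2 : ℂ) • T.q) := by
  obtain ⟨h1, h2, -⟩ := T.herm_basePoint 2
  push_cast at h1 h2
  rw [InHoroball, h1, h2]
  norm_num

theorem isNegative_basePoint : IsNegative (T.q₀ + (1 / 2 : ℂ) • T.q) := by
  obtain ⟨h1, -, -⟩ := T.herm_basePoint (1 / 2)
  push_cast at h1
  rw [IsNegative, h1]
  norm_num

theorem norm_herm_basePoint_lt : ‖herm (T.q₀ + (1 / 2 : ℂ) • T.q) T.q₀‖
    < ‖herm (T.q₀ + (1 / 2 : ℂ) • T.q) T.q‖ := by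
  obtain ⟨-, h2, h3⟩ := T.herm_basePoint (1 / 2)
  push_cast at h2 h3
  rw [h2, h3]
  norm_num

theorem one_mem_identityNhd : 1 ∈ T.identityNhd := by
  refine ⟨?_, ?_⟩
  · rw [map_one]; exact inHoroball_basePoint
  · rw [map_one]; exact norm_herm_basePoint_lt

theorem eq_one_of_mem_identityNhd {A : U21} (hA : A ∈ T.group) (h : A ∈ T.identityNhd) :
    A = 1 :=
  eq_one_of_inBall (mem_stabiliser_of_inHoroball hA inHoroball_basePoint h.1) isNegative_basePoint
    norm_herm_basePoint_lt.le h.2.le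

theorem mem_identityNhd_of_act_eq {A B : U21} {a : ℂ} (ha : a ≠ 0)
    (h : ∀ z, act B z = a • act A z)
    (hA : A ∈ T.identityNhd) : B ∈ T.identityNhd := by
  have ha' : 0 < ‖a‖ := norm_pos_iff.2 ha
  refine ⟨?_, ?_⟩
  · have h1 := hA.1
    rw [InHoroball] at h1 ⊢
    rw [h, re_herm_smul_self, herm_smul_left, norm_mul]
    nlinarith [pow_pos ha' 2]
  · rw [h, herm_smul_left, herm_smul_left, norm_mul, norm_mul]
    exact mul_lt_mul_of_pos_left hA.2 ha'

theorem isOpen_identityNhd : IsOpen T.identityNhd := by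
  have hact : ∀ z : Vec, Continuous fun A : U21 => act A z := fun z =>
    (Units.continuous_val.comp continuous_subtype_val).matrix_mulVec continuous_const
  have hherm : ∀ f g : U21 → Vec, Continuous f → Continuous g →
      Continuous fun A => herm (f A) (g A) := by
    intro f g hf hg
    simp only [herm]
    fun_prop
  simp only [identityNhd, InHoroball, Set.ofPred_and]
  refine IsOpen.inter (isOpen_lt ?_ ?_) (isOpen_lt ?_ ?_)
  · exact Complex.continuous_re.comp (hherm _ _ (hact _) (hact _))
  · exact ((hherm _ _ (hact _) continuous_const).norm.pow 2).neg
  · exact (hherm _ _ (hact _) continuous_const).norm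
  · exact (hherm _ _ (hact _) continuous_const).norm

end AsymptoticTriangle

/-! ### Discreteness of triangle groups -/

theorem four_thirds_le_norm_herm_sq {C D : ComplexGeodesic} (h : C.UltraParallel D ∨ C.Ideal D)
    {c d : Vec} (hc : C.IsNormalisedPolar c) (hd : D.IsNormalisedPolar d)
    (hdist : Real.log 3 ≤ C.dist D) : 4 / 3 ≤ ‖herm c d‖ ^ 2 := by
  rcases h with h | h
  · exact h.four_thirds_le hc hd hdist
  · exact absurd h.dist_lt_log_three (not_lt.2 hdist)

theorem exists_null_of_dist_eq_zero {C D : ComplexGeodesic}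
    (h : C.UltraParallel D ∨ C.Ideal D) {c d : Vec} (hc : C.IsNormalisedPolar c)
    (hd : D.IsNormalisedPolar d) (hdist : C.dist D = 0) :
    ∃ q : Vec, q ≠ 0 ∧ herm q q = 0 ∧ herm q c = 0 ∧ herm q d = 0 := by
  rcases h with h | ⟨p, hp, hp'⟩
  · exact absurd hdist (h.dist_pos hc hd).ne'
  · exact ⟨p.1.rep, p.1.rep_nonzero, p.2, herm_comm_eq_zero (hc.1.herm_rep hp),
      herm_comm_eq_zero (hd.1.herm_rep hp')⟩

theorem ComplexGeodesic.IsNormalisedPolar.smul {C : ComplexGeodesic} {c : Vec}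
    (hc : C.IsNormalisedPolar c) {u : ℂ} (hu : ‖u‖ = 1) : C.IsNormalisedPolar (u • c) := by
  have u0 : u ≠ 0 := fun h => by rw [h, norm_zero] at hu; exact zero_ne_one hu
  have h1 : herm (u • c) (u • c) = 1 := by
    rw [herm_smul_left, herm_smul_right, hc.2, mul_one, Complex.mul_conj,
      Complex.normSq_eq_norm_sq, hu]
    simp
  refine ⟨⟨?_, fun z => ?_⟩, h1⟩
  · rw [IsPositive, h1]; simp
  · rw [hc.1.2 z, herm_smul_left, mul_eq_zero, or_iff_right u0]

/-- A complex reflection is represented by a unitary map that fixes the mirror pointwise; it is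
expressed by any normalised polar vector of the mirror. -/
theorem IsComplexReflection.exists_reflection {n : ℕ} {C : ComplexGeodesic} {g : PU21}
    (hg : IsComplexReflection n C g) {c : Vec} (hc : C.IsNormalisedPolar c) :
    ∃ (μ : ℂ) (B : U21), IsPrimitiveRoot μ n ∧ (∀ z, act B z = reflection μ c z) ∧
      g = QuotientGroup.mk B := by
  obtain ⟨d, μ, A, hd, hμ, hA, rfl⟩ := hg
  obtain ⟨a, a0, rfl⟩ := hc.1.exists_smul_eq hd
  refine ⟨μ, ⟨-A.1, fun z w => ?_⟩, hμ, fun z => ?_, ?_⟩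
  · rw [Units.val_neg, Matrix.neg_mulVec, Matrix.neg_mulVec, ← A.2 z w]
    simp [herm]
  · rw [act_apply]
    change (-A.1).1 *ᵥ z = _
    rw [Units.val_neg, Matrix.neg_mulVec, hA z, reflection, smul_smul, herm_smul_right,
      herm_smul_left, herm_smul_right, hc.2, neg_add, neg_neg, ← neg_smul]
    congr 2
    have : conj a ≠ 0 := (map_ne_zero _).2 a0
    field_simp
    ring
  · rw [QuotientGroup.eq]
    refine ⟨-1, ?_⟩
    have e : (A⁻¹).1.1 * A.1.1 = 1 := by
      rw [← Units.val_mul, ← Subgroup.coe_mul, inv_mul_cancel]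
      rfl
    rw [Subgroup.coe_mul, Units.val_mul]
    change (A⁻¹).1.1 * (-A.1).1 = _
    rw [Units.val_neg, mul_neg, e, neg_one_smul]

theorem AsymptoticTriangle.discreteTopology_map_group (T : AsymptoticTriangle) :
    DiscreteTopology (T.group.map (QuotientGroup.mk' scalars)) := by
  refine discreteTopology_of_isOpen_singleton_one (isOpen_induced_iff.2
    ⟨QuotientGroup.mk '' T.identityNhd, QuotientGroup.isOpenMap_coe _ T.isOpen_identityNhd, ?_⟩)
  ext ⟨g, hg⟩
  simp only [Set.mem_preimage, Set.mem_singleton_iff]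
  constructor
  · rintro ⟨B, hB, rfl⟩
    obtain ⟨A, hA, e⟩ := hg
    obtain ⟨a, ha⟩ : B⁻¹ * A ∈ scalars := QuotientGroup.eq.1 e.symm
    have h : ∀ z, act A z = a • act B z := by
      intro z
      have h1 : act (B⁻¹ * A) z = a • z := by
        rw [act_apply, ha, Matrix.smul_mulVec, Matrix.one_mulVec]
      rw [← map_smul, ← h1, ← act_mul_apply, mul_inv_cancel_left]
    have a0 : a ≠ 0 := by
      intro h0
      have h1 := act_inv_apply A T.q
      rw [h, h0, zero_smul, map_zero] at h1
      exact T.q_ne_zero h1.symm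
    have hA1 : A = 1 := eq_one_of_mem_identityNhd hA (mem_identityNhd_of_act_eq a0 h hB)
    refine Subtype.ext ?_
    change (QuotientGroup.mk B : PU21) = 1
    rw [← e, hA1, map_one]
  · intro h
    have h' : g = 1 := congrArg Subtype.val h
    rw [h']
    exact ⟨1, T.one_mem_identityNhd, rfl⟩

/-- Polar vectors of two asymptotic geodesics can be chosen such that they differ by a null vector;
the phase that achieves this for `e` is the conjugate of `⟨e, c⟩`. -/
theorem conj_herm_smul_sub_eq {q c d e : Vec} (hq : herm q q = 0) (hqc : herm q c = 0)
    (hc : herm c c = 1) (hqd : herm q d = 1) (hqe : herm q e = 0) (he : herm e e = 1) :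
    ‖herm e c‖ = 1 ∧
      conj (herm e c) • e = c + (herm (conj (herm e c) • e) d - herm c d) • q := by
  have h1 : e - herm e c • c = herm (e - herm e c • c) d • q :=
    eq_smul_of_orthogonal hq hqc hc hqd
      (by rw [herm_sub_left, herm_smul_left, herm_comm_eq_zero hqe, herm_comm_eq_zero hqc]; ring)
      (by rw [herm_sub_left, herm_smul_left, hc]; ring)
  have h2 : ‖herm e c‖ = 1 := by
    have := re_herm_sub_proj (x := e) (e := c) (by rw [hc]; exact one_ne_zero)
    rw [hc, he, div_one, h1, re_herm_smul_self, hq, Complex.zero_re, mul_zero, Complex.one_re,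
      div_one] at this
    nlinarith [norm_nonneg (herm e c)]
  refine ⟨h2, ?_⟩
  have h3 : herm (conj (herm e c) • e) c = 1 := by
    rw [herm_smul_left, mul_comm, Complex.mul_conj, Complex.normSq_eq_norm_sq, h2]
    simp
  have h4 := eq_smul_of_orthogonal (x := conj (herm e c) • e - c) hq hqc hc hqd
      (by rw [herm_sub_left, herm_smul_left, herm_comm_eq_zero hqe, herm_comm_eq_zero hqc]; ring)
      (by rw [herm_sub_left, h3, hc]; ring)
  rw [herm_sub_left] at h4
  rw [← h4]
  module

theorem IsUltraParallelTriangleGroup.exists_asymptoticTriangle {m α : ℝ} (hm : Real.log 3 ≤ m)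
    (hα : Real.cos α ≤ -1 / 2) {Γ : Subgroup PU21}
    (hΓ : IsUltraParallelTriangleGroup Γ ![m, m, 0] ![2, 3, 2] α) :
    ∃ T : AsymptoticTriangle, Γ = T.group.map (QuotientGroup.mk' scalars) := by
  obtain ⟨C, ι, htri, ⟨c, hc, hang⟩, hι, rfl⟩ := hΓ
  obtain ⟨t0, d0⟩ : ((C 2).UltraParallel (C 1) ∨ (C 2).Ideal (C 1)) ∧ (C 2).dist (C 1) = m :=
    htri 0
  obtain ⟨t1, d1⟩ : ((C 0).UltraParallel (C 2) ∨ (C 0).Ideal (C 2)) ∧ (C 0).dist (C 2) = m :=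
    htri 1
  obtain ⟨t2, d2⟩ : ((C 1).UltraParallel (C 0) ∨ (C 1).Ideal (C 0)) ∧ (C 1).dist (C 0) = 0 :=
    htri 2
  have n1 := four_thirds_le_norm_herm_sq t1 (hc 0) (hc 2) (d1 ▸ hm)
  have n2 := four_thirds_le_norm_herm_sq t0 (hc 2) (hc 1) (d0 ▸ hm)
  obtain ⟨q', q'0, hq', hq'1, hq'0⟩ := exists_null_of_dist_eq_zero t2 (hc 1) (hc 0) d2
  have hq'2 : herm q' (c 2) ≠ 0 := by
    intro h
    have := re_herm_self_nonneg (x := c 0 - (herm (c 0) (c 2) / herm (c 2) (c 2)) • c 2) q'0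
      (by rw [hq']; simp) (by
        rw [herm_sub_left, herm_smul_left, herm_comm_eq_zero hq'0, herm_comm_eq_zero h]; ring)
    rw [re_herm_sub_proj (by rw [(hc 2).2]; exact one_ne_zero), (hc 2).2, (hc 0).2,
      Complex.one_re, div_one] at this
    linarith
  set q := (herm q' (c 2))⁻¹ • q' with hq
  have qq : herm q q = 0 := by rw [hq, herm_smul_left, herm_smul_right, hq']; ring
  have q0 : herm q (c 0) = 0 := by rw [hq, herm_smul_left, hq'0]; ring
  have q1 : herm q (c 1) = 0 := by rw [hq, herm_smul_left, hq'1]; ring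
  have q2 : herm q (c 2) = 1 := by rw [hq, herm_smul_left, inv_mul_cancel₀ hq'2]
  obtain ⟨hu, hc₂⟩ := conj_herm_smul_sub_eq qq q0 (hc 0).2 q2 q1 (hc 1).2
  set u := conj (herm (c 1) (c 0)) with hu'
  have hu1 : ‖u‖ = 1 := by rw [hu', Complex.norm_conj, hu]
  obtain ⟨μ₁, A₁, hμ₁, hA₁, e₁⟩ := (hι 0).exists_reflection (hc 0)
  obtain ⟨ω, A₂, hω, hA₂, e₂⟩ := (hι 1).exists_reflection ((hc 1).smul hu1)
  obtain ⟨μ₃, A₃, hμ₃, hA₃, e₃⟩ := (hι 2).exists_reflection (hc 2)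
  rw [hc₂] at hA₂
  obtain rfl : μ₁ = -1 := IsPrimitiveRoot.eq_neg_one_of_two_right hμ₁
  obtain rfl : μ₃ = -1 := IsPrimitiveRoot.eq_neg_one_of_two_right hμ₃
  have hω' : ω ^ 2 + ω + 1 = 0 := by
    have h3 : IsPrimitiveRoot ω 3 := hω
    have := h3.geom_sum_eq_zero (by norm_num)
    simp only [Finset.sum_range_succ, Finset.sum_range_zero] at this
    linear_combination this
  have hx₂ : herm (c 0) (c 2) + (herm (u • c 1) (c 2) - herm (c 0) (c 2)) = herm (u • c 1) (c 2) := by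
    ring
  have hx₂n : ‖herm (u • c 1) (c 2)‖ = ‖herm (c 2) (c 1)‖ := by
    rw [herm_smul_left, norm_mul, hu1, one_mul, norm_herm_comm]
  have hprod : ∏ k : Fin 3, herm (c (k - 1)) (c (k + 1))
      = herm (c 0) (c 2) * conj (herm (u • c 1) (c 2)) := by
    rw [Fin.prod_univ_three]
    change herm (c 2) (c 1) * herm (c 0) (c 2) * herm (c 1) (c 0) = _
    rw [herm_smul_left, map_mul, hu', Complex.conj_conj, conj_herm]
    ring
  have hcos := congrArg Real.Angle.cos hang
  rw [Real.Angle.cos_coe, Real.Angle.cos_coe, hprod] at hcos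
  let T : AsymptoticTriangle :=
    { q := q, c₁ := c 0, c₃ := c 2, β := herm (u • c 1) (c 2) - herm (c 0) (c 2), ω := ω
      A₁ := A₁, A₂ := A₂, A₃ := A₃
      herm_q_q := qq, herm_q_c₁ := q0, herm_c₁_c₁ := (hc 0).2, herm_q_c₃ := q2
      herm_c₃_c₃ := (hc 2).2, omega_eq := hω'
      act_A₁ := hA₁, act_A₂ := hA₂, act_A₃ := hA₃
      le_x₁ := n1
      le_x₂ := by rw [hx₂, hx₂n]; exact n2
      angle := by
        rw [hx₂, ← Complex.norm_mul_cos_arg, hcos, norm_mul, Complex.norm_conj]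
        have : 0 ≤ ‖herm (c 0) (c 2)‖ * ‖herm (u • c 1) (c 2)‖ := by positivity
        nlinarith }
  refine ⟨T, ?_⟩
  rw [AsymptoticTriangle.group, MonoidHom.map_closure]
  congr 1
  have hrange : Set.range ι = {ι 0, ι 1, ι 2} := by
    ext g
    simp [Fin.exists_fin_succ, eq_comm]
  rw [hrange, Set.image_insert_eq, Set.image_pair, e₁, e₂, e₃]
  rfl

end ComplexHyperbolic

theorem proposition1p2 (m α : ℝ) (hm : Real.log 3 ≤ m) (hα : Real.cos α ≤ -1 / 2)
    (Γ : Subgroup ComplexHyperbolic.PU21)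
    (hΓ : ComplexHyperbolic.IsUltraParallelTriangleGroup Γ ![m, m, 0] ![2, 3, 2] α) :
    DiscreteTopology Γ := by
  obtain ⟨T, rfl⟩ := hΓ.exists_asymptoticTriangle hm hα
  exact T.discreteTopology_map_group
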